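/- Let $n$ be a dimension. A weight on $\mathbb{R}^n$ is a non-negative locally integrable function $w$; we write $w(E)=\int_E w\,dx$, and $\Delta(x,r)$ for the open Euclidean ball. The weight $w$ is doubling if the measure $w\,dx$ is non-zero and there is a constant $C<\infty$ with $w(\Delta(x,2r))\le C\,w(\Delta(x,r))$ for all $x\in\mathbb{R}^n$, $r>0$; the least such $C$ is the doubling constant of $w$. Let $\phi(x)=\pi^{-n/2}e^{-|x|^2}$ and $\phi_r(x)=r^{-n}\phi(x/r)$, and define the measure $\mu_w$ on $\mathbb{R}^n\times(0,\infty)$ by $$d\mu_w(x,r)=|\nabla_x\log(w*\phi_r)(x)|^2\,r\,dx\,dr .$$ For a Borel measure $\mu$ on $\mathbb{R}^n\times(0,\infty)$ let $$\|\mu\|_{\mathcal C}=\sup_{x\in\mathbb{R}^n,\ r>0}\frac{\mu\big(\Delta(x,r)\times(0,r)\big)}{|\Delta(x,r)|}$$ be its Carleson norm. Let $[w]_{A_\infty}\in[0,\infty]$ be the infimum of the constants $C<\infty$ such that $$\frac1{|\Delta(x,r)|}\int_{\Delta(x,r)}w\,dz\le C\exp\Big(\frac1{|\Delta(x,r)|}\int_{\Delta(x,r)}\log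 w\,dz\Big)\qquad\text{for all }x\in\mathbb{R}^n,\ r>0,$$ with $\log 0=-\infty$, $\exp(-\infty)=0$, and $[w]_{A_\infty}=\infty$ if there is no such $C$. **Theorem.** For every dimension $n$, every $D<\infty$ and every $\epsilon_0>0$ there is $\delta_0>0$, depending only on $n$, $D$ and $\epsilon_0$, such that for every doubling weight $w$ on $\mathbb{R}^n$ with doubling constant at most $D$, $$\|\mu_w\|_{\mathcal C}\le\delta_0\quad\Longrightarrow\quad[w]_{A_\infty}\le 1+\epsilon_0 .$$ -/

import Mathlib

open MeasureTheory Metric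
open scoped ENNReal NNReal Convolution Gradient

noncomputable section

/-- A weight on `ℝⁿ`: a locally integrable function that is non-negative (almost everywhere). -/
structure IsWeight {n : ℕ} (w : EuclideanSpace ℝ (Fin n) → ℝ) : Prop where
  locallyIntegrable : LocallyIntegrable w volume
  nonneg : ∀ᵐ x, 0 ≤ w x

/-- The measure `w dx`. -/
def weightMeasure {n : ℕ} (w : EuclideanSpace ℝ (Fin n) → ℝ) :
    Measure (EuclideanSpace ℝ (Fin n)) :=
  volume.withDensity fun x => ENNReal.ofReal (w x)

/-- `ν(Δ(x, 2r)) ≤ C ν(Δ(x, r))` for all balls. -/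
def DoublingBound {n : ℕ} (ν : Measure (EuclideanSpace ℝ (Fin n))) (C : ℝ≥0) : Prop :=
  ∀ (x : EuclideanSpace ℝ (Fin n)) (r : ℝ), 0 < r → ν (ball x (2 * r)) ≤ C * ν (ball x r)

/-- A doubling measure: non-trivial, and the doubling inequality holds with some finite constant. -/
def IsDoubling {n : ℕ} (ν : Measure (EuclideanSpace ℝ (Fin n))) : Prop :=
  ν ≠ 0 ∧ ∃ C : ℝ≥0, DoublingBound ν C

/-- The doubling constant of a doubling measure: the least admissible constant. -/
def doublingConstant {n : ℕ} (ν : Measure (EuclideanSpace ℝ (Fin n))) : ℝ≥0 :=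
  sInf {C : ℝ≥0 | DoublingBound ν C}

/-- The Gaussian `φ(x) = π^{-n/2} e^{-|x|²}`. -/
def gaussianKernel (n : ℕ) (x : EuclideanSpace ℝ (Fin n)) : ℝ :=
  Real.pi ^ (-(n : ℝ) / 2) * Real.exp (-‖x‖ ^ 2)

/-- The dilation `f_r(x) = r^{-n} f(x / r)`. -/
def dilation {n : ℕ} (f : EuclideanSpace ℝ (Fin n) → ℝ) (r : ℝ)
    (x : EuclideanSpace ℝ (Fin n)) : ℝ :=
  (r ^ n)⁻¹ * f (r⁻¹ • x)

/-- The smooth average `(w * φ_r)(x)`. -/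
def gaussianAverage {n : ℕ} (w : EuclideanSpace ℝ (Fin n) → ℝ) (r : ℝ) :
    EuclideanSpace ℝ (Fin n) → ℝ :=
  w ⋆[ContinuousLinearMap.lsmul ℝ ℝ, volume] dilation (gaussianKernel n) r

/-- The measure `dμ_w(x, r) = |∇ₓ log (w * φ_r)(x)|² r dx dr` on `ℝⁿ × (0, ∞)`, regarded as a
measure on `ℝⁿ × ℝ` concentrated on `ℝⁿ × (0, ∞)`. -/
def carlesonMeasure {n : ℕ} (w : EuclideanSpace ℝ (Fin n) → ℝ) :
    Measure (EuclideanSpace ℝ (Fin n) × ℝ) :=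
  ((volume : Measure (EuclideanSpace ℝ (Fin n) × ℝ)).restrict
      (Set.univ ×ˢ Set.Ioi (0 : ℝ))).withDensity
    fun p => ENNReal.ofReal (‖∇ (fun y => Real.log (gaussianAverage w p.2 y)) p.1‖ ^ 2 * p.2)

/-- The Carleson norm `sup_Δ |Δ|⁻¹ μ(T_Δ)`, where `T_Δ = Δ(x, r) × (0, r)` for `Δ = Δ(x, r)`. -/
def carlesonNorm {n : ℕ} (μ : Measure (EuclideanSpace ℝ (Fin n) × ℝ)) : ℝ≥0∞ :=
  ⨆ (x : EuclideanSpace ℝ (Fin n)) (r : ℝ) (_ : 0 < r),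
    (volume (ball x r))⁻¹ * μ (ball x r ×ˢ Set.Ioo 0 r)

open Classical in
/-- `exp (⨍_{Δ(x, r)} log w)`, with the conventions `log 0 = -∞` and `exp (-∞) = 0`. For a weight
`w` we have `log w ≤ w`, so the average of `log w` always exists in `[-∞, ∞)`; it equals `-∞`
exactly when `w` vanishes on a subset of the ball of positive measure or `log w` is not integrable
on the ball. -/
def geometricMean {n : ℕ} (w : EuclideanSpace ℝ (Fin n) → ℝ)
    (x : EuclideanSpace ℝ (Fin n)) (r : ℝ) : ℝ :=
  if (∀ᵐ z ∂(volume.restrict (ball x r)), 0 < w z) ∧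
      IntegrableOn (fun z => Real.log (w z)) (ball x r) volume then
    Real.exp (⨍ z in ball x r, Real.log (w z))
  else 0

/-- `⨍_Δ w ≤ C exp (⨍_Δ log w)` for all balls `Δ`. -/
def AInftyBound {n : ℕ} (w : EuclideanSpace ℝ (Fin n) → ℝ) (C : ℝ≥0) : Prop :=
  ∀ (x : EuclideanSpace ℝ (Fin n)) (r : ℝ), 0 < r →
    (⨍ z in ball x r, w z) ≤ C * geometricMean w x r

/-- The `A_∞` characteristic `[w]_{A_∞}`: the infimum of the admissible constants; it is `∞` when
there is none, that is, when `w` is not in `A_∞`. -/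
def aInftyConstant {n : ℕ} (w : EuclideanSpace ℝ (Fin n) → ℝ) : ℝ≥0∞ :=
  ⨅ (C : ℝ≥0) (_ : AInftyBound w C), (C : ℝ≥0∞)

end

/-! Write `u_r = w * φ_r`. The Gaussian makes `u` a solution of `∂_r u = (r/2) Δu`, so `∂_r log u =
(r/2)(Δ log u + |∇ log u|²)`. Doubling gives a Harnack-type control of all derivatives of `u_r` by
`u_r` itself (`DoublingBound.integral_sq_mul_heatKernel_le_heatAverage`).

Fix a ball `B` of radius `R` and a cutoff `ψ` equal to 1 on `B` and supported in `(1+κ)B`. Testing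
the equation against `ψ` and integrating over scales from `ρ` to `σ` bounds `∫ ψ log u_σ - ∫ ψ log
u_ρ` by the Carleson mass plus a term `(σ sup|∇ψ|)² |2B|`, uniformly in `ρ`
(`DoublingBound.integral_mul_log_sub_le`). Both terms are small when `σ ≤ τR` with `τ` and the
Carleson norm small.

The Carleson condition also provides a scale `σ` comparable to `τR` at which `log u_σ` is within `η`
of a constant `c` on `2B` (`exists_carleson_oscillation`). This yields `w(B)/|B| ≤ e^{c+3η}`
(`DoublingBound.measureReal_ball_le_exp`), and it remains to show that the mean of `log w` over `B`
is at least `c` minus a small error.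

To pass from `ψ` to `B`, the logarithm is truncated at height `c+m`. The excess `(log u_ρ - c - m)₊`
is at most `e^{-c-m} u_ρ`, whose integral over `2B` is `O(e^{-m}) |B|` by doubling; the collar
`(1+κ)B \ B` costs about `m((1+κ)^n - 1)|B|`
(`DoublingBound.integral_max_sub_log_le_of_oscillation`). The truncated deficits `(c+m-log u_ρ)₊`
are non-negative, so Fatou's lemma and Lebesgue differentiation let `ρ → 0` without assuming in
advance that `log w` is integrable (`IsWeight.integrableOn_log_of_forall_integral_le`). -/

/-! ### Doubling measures: positivity of balls and integrals of exponentially decaying functions. -/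

section Doubling

variable {n : ℕ} {ν : Measure (EuclideanSpace ℝ (Fin n))} {D : ℝ≥0}

lemma DoublingBound.mono {C : ℝ≥0} (h : DoublingBound ν C) (hC : C ≤ D) : DoublingBound ν D :=
  fun x r hr => (h x r hr).trans (by gcongr)

lemma DoublingBound.ball_pow_le (h : DoublingBound ν D) (x : EuclideanSpace ℝ (Fin n)) {r : ℝ}
    (hr : 0 < r) (k : ℕ) : ν (ball x (2 ^ k * r)) ≤ (D : ℝ≥0∞) ^ k * ν (ball x r) := by
  induction k with
  | zero => simp
  | succ k ih =>
    calc ν (ball x (2 ^ (k + 1) * r)) = ν (ball x (2 * (2 ^ k * r))) := by ring_nf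
      _ ≤ D * ν (ball x (2 ^ k * r)) := h x _ (by positivity)
      _ ≤ D * ((D : ℝ≥0∞) ^ k * ν (ball x r)) := by gcongr
      _ = _ := by ring

/-- Doubling would propagate nullity from one ball to its dilates, which exhaust the space. -/
lemma DoublingBound.ball_pos (h : DoublingBound ν D) (hν : ν ≠ 0)
    (x : EuclideanSpace ℝ (Fin n)) {r : ℝ} (hr : 0 < r) : 0 < ν (ball x r) := by
  rw [pos_iff_ne_zero]
  intro h0
  apply hν
  rw [← Measure.measure_univ_eq_zero]
  have : (Set.univ : Set (EuclideanSpace ℝ (Fin n))) = ⋃ k : ℕ, ball x (2 ^ k * r) := by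
    symm
    rw [Set.eq_univ_iff_forall]
    intro y
    obtain ⟨k, hk⟩ := pow_unbounded_of_one_lt (dist y x / r) (one_lt_two : (1 : ℝ) < 2)
    exact Set.mem_iUnion.2 ⟨k, by rw [mem_ball]; rwa [div_lt_iff₀ hr] at hk⟩
  rw [this, measure_iUnion_null_iff]
  intro k
  have := h.ball_pow_le x hr k
  rw [h0, mul_zero] at this
  exact le_antisymm this bot_le

/-- The constant in `DoublingBound.lintegral_exp_le`. -/
noncomputable def expConst (D : ℝ≥0) : ℝ≥0 :=
  (∑' k : ℕ, ENNReal.ofReal (Real.exp (1 - 2 ^ k / 2)) * (D : ℝ≥0∞) ^ k).toNNReal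

lemma tsum_exp_mul_pow_ne_top (D : ℝ≥0) :
    ∑' k : ℕ, ENNReal.ofReal (Real.exp (1 - 2 ^ k / 2)) * (D : ℝ≥0∞) ^ k ≠ ⊤ := by
  -- With `2D < 2^m`, `D^k ≤ 2^{(m-1)k}`, while the `m`-th Taylor term gives `exp(2^k/2) ≥ c
  -- 2^{mk}`; the quotient decays like `2^{-k}`.
  obtain ⟨m, hm⟩ := pow_unbounded_of_one_lt (2 * D : ℝ) (one_lt_two : (1 : ℝ) < 2)
  have hle : ∀ k : ℕ, Real.exp (1 - 2 ^ k / 2) * (D : ℝ) ^ k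
      ≤ Real.exp 1 * m.factorial * 2 ^ m * (1 / 2) ^ k := by
    intro k
    have h1 : ((2 : ℝ) ^ k / 2) ^ m / m.factorial ≤ Real.exp (2 ^ k / 2) :=
      Real.pow_div_factorial_le_exp _ (by positivity) m
    rw [Real.exp_sub, div_mul_eq_mul_div, div_le_iff₀ (Real.exp_pos _)]
    have h2 : (D : ℝ) ^ k ≤ (2 ^ m / 2) ^ k := by
      gcongr
      linarith
    calc Real.exp 1 * (D : ℝ) ^ k ≤ Real.exp 1 * (2 ^ m / 2) ^ k := by gcongr
      _ = Real.exp 1 * m.factorial * 2 ^ m * (1 / 2) ^ k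
            * (((2 : ℝ) ^ k / 2) ^ m / m.factorial) := by
          have : (m.factorial : ℝ) ≠ 0 := by positivity
          rw [one_div, inv_pow, div_pow, div_pow, ← pow_mul, ← pow_mul, mul_comm m k]
          field_simp
      _ ≤ _ := by gcongr
  have hs : Summable fun k : ℕ => Real.exp (1 - 2 ^ k / 2) * (D : ℝ) ^ k :=
    Summable.of_nonneg_of_le (fun k => by positivity) hle
      ((summable_geometric_of_lt_one (by norm_num) (by norm_num)).mul_left _)
  have := hs.tsum_ofReal_ne_top
  convert this using 4 with k
  rw [ENNReal.ofReal_mul (Real.exp_pos _).le, ENNReal.ofReal_pow D.coe_nonneg,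
    ENNReal.ofReal_coe_nnreal]

lemma DoublingBound.lintegral_exp_le (h : DoublingBound ν D) (x : EuclideanSpace ℝ (Fin n))
    {r : ℝ} (hr : 0 < r) :
    ∫⁻ y, ENNReal.ofReal (Real.exp (-(‖x - y‖ / r))) ∂ν ≤ expConst D * ν (ball x r) := by
  have hpt : ∀ y, ENNReal.ofReal (Real.exp (-(‖x - y‖ / r))) ≤
      ∑' k : ℕ, (ball x (2 ^ k * r)).indicator
        (fun _ => ENNReal.ofReal (Real.exp (1 - 2 ^ k / 2))) y := by
    intro y
    have hex : ∃ k : ℕ, ‖x - y‖ / r < 2 ^ k :=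
      pow_unbounded_of_one_lt (‖x - y‖ / r) (one_lt_two : (1 : ℝ) < 2)
    classical
    -- Only the term of the first dyadic ball containing `y` is kept: `y` lies outside the preceding
    -- ball, which bounds the exponential. The extra 1 in the exponent covers `k = 0`, where there
    -- is no preceding ball.
    refine le_trans ?_ (ENNReal.le_tsum (Nat.find hex))
    have hk := Nat.find_spec hex
    have hmin := fun j => Nat.find_min (H := hex) (m := j)
    generalize Nat.find hex = k at hk hmin
    have hy : y ∈ ball x (2 ^ k * r) := by
      rw [mem_ball', dist_eq_norm]
      rwa [div_lt_iff₀ hr] at hk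
    rw [Set.indicator_of_mem hy]
    apply ENNReal.ofReal_le_ofReal
    apply Real.exp_le_exp.2
    have h0 : 0 ≤ ‖x - y‖ / r := by positivity
    rcases k with _ | k
    · norm_num
      linarith
    · have := not_lt.1 (hmin k (Nat.lt_succ_self k))
      rw [pow_succ]
      linarith
  calc ∫⁻ y, ENNReal.ofReal (Real.exp (-(‖x - y‖ / r))) ∂ν
      ≤ ∫⁻ y, ∑' k : ℕ, (ball x (2 ^ k * r)).indicator
        (fun _ => ENNReal.ofReal (Real.exp (1 - 2 ^ k / 2))) y ∂ν := lintegral_mono hpt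
    _ = ∑' k : ℕ, ENNReal.ofReal (Real.exp (1 - 2 ^ k / 2)) * ν (ball x (2 ^ k * r)) := by
        rw [lintegral_tsum]
        · congr 1
          ext k
          rw [lintegral_indicator_const measurableSet_ball]
        · intro k
          exact (measurable_const.indicator measurableSet_ball).aemeasurable
    _ ≤ ∑' k : ℕ, ENNReal.ofReal (Real.exp (1 - 2 ^ k / 2)) * (D : ℝ≥0∞) ^ k * ν (ball x r) := by
        refine ENNReal.tsum_le_tsum fun k => ?_
        rw [mul_assoc]
        gcongr
        exact h.ball_pow_le x hr k
    _ = _ := by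
        rw [ENNReal.tsum_mul_right, expConst, ENNReal.coe_toNNReal (tsum_exp_mul_pow_ne_top D)]

variable [IsLocallyFiniteMeasure ν]

lemma measure_ball_lt_top' (x : EuclideanSpace ℝ (Fin n)) (r : ℝ) : ν (ball x r) < ⊤ :=
  (measure_mono ball_subset_closedBall).trans_lt (isCompact_closedBall x r).measure_lt_top

lemma DoublingBound.integrable_exp (h : DoublingBound ν D) (x : EuclideanSpace ℝ (Fin n))
    {r : ℝ} (hr : 0 < r) : Integrable (fun y => Real.exp (-(‖x - y‖ / r))) ν := by
  refine ⟨(by fun_prop : Continuous fun y => Real.exp (-(‖x - y‖ / r))).aestronglyMeasurable, ?_⟩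
  rw [hasFiniteIntegral_iff_ofReal (Filter.Eventually.of_forall fun y => (Real.exp_pos _).le)]
  exact (h.lintegral_exp_le x hr).trans_lt
    (ENNReal.mul_lt_top ENNReal.coe_lt_top (measure_ball_lt_top' x r))

lemma DoublingBound.integral_exp_le (h : DoublingBound ν D) (x : EuclideanSpace ℝ (Fin n))
    {r : ℝ} (hr : 0 < r) :
    ∫ y, Real.exp (-(‖x - y‖ / r)) ∂ν ≤ expConst D * ν.real (ball x r) := by
  rw [integral_eq_lintegral_of_nonneg_ae (Filter.Eventually.of_forall fun y => (Real.exp_pos _).le)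
    (by fun_prop : Continuous fun y => Real.exp (-(‖x - y‖ / r))).aestronglyMeasurable]
  have := ENNReal.toReal_mono
    (ENNReal.mul_lt_top ENNReal.coe_lt_top (measure_ball_lt_top' x r)).ne
    (h.lintegral_exp_le x hr)
  simpa [Measure.real] using this

lemma DoublingBound.ball_real_pos (h : DoublingBound ν D) (hν : ν ≠ 0)
    (x : EuclideanSpace ℝ (Fin n)) {r : ℝ} (hr : 0 < r) : 0 < ν.real (ball x r) :=
  ENNReal.toReal_pos (h.ball_pos hν x hr).ne' (measure_ball_lt_top' x r).ne

end Doubling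

/-! ### The Gaussian kernel: derivatives and comparison with an exponential. -/

section Kernel

variable {n : ℕ}

/-- The explicit form of the dilated Gaussian kernel. -/
noncomputable def heatKernel (r : ℝ) (z : EuclideanSpace ℝ (Fin n)) : ℝ :=
  (r ^ n)⁻¹ * (Real.pi ^ (-(n : ℝ) / 2) * Real.exp (-(‖z‖ / r) ^ 2))

lemma dilation_gaussianKernel_eq_heatKernel :
    dilation (gaussianKernel n) = heatKernel := by
  ext r z
  simp only [dilation, gaussianKernel, heatKernel, norm_smul, norm_inv, Real.norm_eq_abs]
  congr 4
  rw [mul_pow, inv_pow, sq_abs, div_pow]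
  ring

lemma heatKernel_pos {r : ℝ} (hr : 0 < r) (z : EuclideanSpace ℝ (Fin n)) : 0 < heatKernel r z := by
  unfold heatKernel
  positivity

lemma continuous_heatKernel (r : ℝ) :
    Continuous (heatKernel r : EuclideanSpace ℝ (Fin n) → ℝ) := by
  unfold heatKernel
  fun_prop

lemma measurable_heatKernel :
    Measurable fun p : ℝ × EuclideanSpace ℝ (Fin n) => heatKernel p.1 p.2 := by
  unfold heatKernel
  fun_prop

/-- The constant in the comparison of the Gaussian with an exponential. -/
noncomputable def kernelConst (n : ℕ) : ℝ := Real.pi ^ (-(n : ℝ) / 2) * Real.exp 3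

lemma kernelConst_pos (n : ℕ) : 0 < kernelConst n := by
  unfold kernelConst
  positivity

/-- The weight `(1+q)²` absorbs the polynomial factors created by one derivative in the scale or two
in space, so this single bound serves for all of them. Exponential decay is preferred to Gaussian
decay because moving the centre by `r` costs only a factor `e` (`exp_neg_norm_sub_le`). -/
lemma sq_mul_heatKernel_le {r : ℝ} (hr : 0 < r) (z : EuclideanSpace ℝ (Fin n)) :
    (1 + ‖z‖ / r) ^ 2 * heatKernel r z
      ≤ kernelConst n * (r ^ n)⁻¹ * Real.exp (-(‖z‖ / r)) := by
  unfold heatKernel kernelConst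
  have hq : 0 ≤ ‖z‖ / r := by positivity
  set q := ‖z‖ / r
  have h1 : (1 + q) ^ 2 ≤ Real.exp (2 * q) := by
    rw [two_mul, Real.exp_add, sq]
    have := Real.add_one_le_exp q
    gcongr <;> linarith
  have h2 : (1 + q) ^ 2 * Real.exp (-q ^ 2) ≤ Real.exp 3 * Real.exp (-q) := by
    calc _ ≤ Real.exp (2 * q) * Real.exp (-q ^ 2) := by gcongr
      _ = Real.exp (2 * q + -q ^ 2) := by rw [Real.exp_add]
      -- The maximum of `3q - q²` is `9/4`, at `q = 3/2`; hence the constant `e³`.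
      _ ≤ Real.exp (3 + -q) := Real.exp_le_exp.2 (by nlinarith [sq_nonneg (q - 3 / 2)])
      _ = _ := Real.exp_add _ _
  have h3 : 0 ≤ (r ^ n)⁻¹ * Real.pi ^ (-(n : ℝ) / 2) := by positivity
  nlinarith [mul_le_mul_of_nonneg_left h2 h3]

lemma le_heatKernel {r : ℝ} (hr : 0 < r) {z : EuclideanSpace ℝ (Fin n)} (hz : ‖z‖ ≤ r) :
    (r ^ n)⁻¹ * (Real.pi ^ (-(n : ℝ) / 2) * Real.exp (-1)) ≤ heatKernel r z := by
  unfold heatKernel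
  have : ‖z‖ / r ≤ 1 := (div_le_one hr).2 hz
  have h0 : 0 ≤ ‖z‖ / r := by positivity
  gcongr
  nlinarith

lemma hasFDerivAt_heatKernel {r : ℝ} (z : EuclideanSpace ℝ (Fin n)) :
    HasFDerivAt (heatKernel r) (innerSL ℝ ((-(2 / r ^ 2) * heatKernel r z) • z)) z := by
  have h1 : HasFDerivAt (fun z : EuclideanSpace ℝ (Fin n) => ‖z‖ ^ 2) (2 • innerSL ℝ z) z :=
    (hasStrictFDerivAt_norm_sq z).hasFDerivAt
  have h2 : (heatKernel r : EuclideanSpace ℝ (Fin n) → ℝ) = fun z =>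
      (r ^ n)⁻¹ * (Real.pi ^ (-(n : ℝ) / 2) * Real.exp (-(r ^ 2)⁻¹ * ‖z‖ ^ 2)) := by
    ext z
    unfold heatKernel
    congr 3
    rw [div_pow]
    ring
  have h3 := (((h1.const_mul (-(r ^ 2)⁻¹)).exp).const_mul
    (Real.pi ^ (-(n : ℝ) / 2))).const_mul ((r ^ n)⁻¹)
  rw [h2]
  refine h3.congr_fderiv ?_
  ext v
  simp
  ring

lemma hasDerivAt_heatKernel {r : ℝ} (hr : 0 < r) (z : EuclideanSpace ℝ (Fin n)) :
    HasDerivAt (fun s => heatKernel s z)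
      ((-(n / r) + 2 / r * (‖z‖ / r) ^ 2) * heatKernel r z) r := by
  have h1 : HasDerivAt (fun s : ℝ => -(‖z‖ / s) ^ 2) (2 / r * (‖z‖ / r) ^ 2) r := by
    refine ((((hasDerivAt_const r ‖z‖).fun_div (hasDerivAt_id r) hr.ne').fun_pow 2).fun_neg
      ).congr_deriv ?_
    simp
    field_simp
  have h2 : HasDerivAt (fun s : ℝ => (s ^ n)⁻¹) (-(n / r) * (r ^ n)⁻¹) r := by
    refine ((hasDerivAt_pow n r).fun_inv (pow_ne_zero n hr.ne')).congr_deriv ?_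
    rcases n with _ | n
    · simp
    · field_simp
      simp [pow_succ]
  refine (h2.fun_mul ((h1.exp).const_mul (Real.pi ^ (-(n : ℝ) / 2)))).congr_deriv ?_
  unfold heatKernel
  ring

lemma exp_neg_norm_sub_le {r : ℝ} (hr : 0 < r) {x x₀ : EuclideanSpace ℝ (Fin n)}
    (hx : x ∈ ball x₀ r) (y : EuclideanSpace ℝ (Fin n)) :
    Real.exp (-(‖x - y‖ / r)) ≤ Real.exp 1 * Real.exp (-(‖x₀ - y‖ / r)) := by
  rw [← Real.exp_add]
  apply Real.exp_le_exp.2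
  have h1 : ‖x₀ - y‖ ≤ r + ‖x - y‖ := by
    have h2 : ‖x₀ - x‖ < r := by rwa [mem_ball', dist_eq_norm] at hx
    have := norm_sub_le_norm_sub_add_norm_sub x₀ x y
    linarith
  have : ‖x₀ - y‖ / r ≤ 1 + ‖x - y‖ / r := by
    rw [div_le_iff₀ hr, add_mul, one_mul, div_mul_cancel₀ _ hr.ne']
    exact h1
  linarith

end Kernel

/-! ### Gaussian averages of a measure and joint measurability in point and scale. -/

section Average

variable {n : ℕ} (ν : Measure (EuclideanSpace ℝ (Fin n)))

/-- The Gaussian average of a measure. -/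
noncomputable def heatAverage (r : ℝ) (x : EuclideanSpace ℝ (Fin n)) : ℝ :=
  ∫ y, heatKernel r (x - y) ∂ν

/-- The spatial gradient of the Gaussian average of a measure. -/
noncomputable def heatGradient (r : ℝ) (x : EuclideanSpace ℝ (Fin n)) : EuclideanSpace ℝ (Fin n) :=
  ∫ y, (-(2 / r ^ 2) * heatKernel r (x - y)) • (x - y) ∂ν

/-- The derivative of the Gaussian average of a measure in the scale. -/
noncomputable def heatScaleDeriv (r : ℝ) (x : EuclideanSpace ℝ (Fin n)) : ℝ :=
  ∫ y, (-(n / r) + 2 / r * (‖x - y‖ / r) ^ 2) * heatKernel r (x - y) ∂ν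

variable [SFinite ν]

lemma measurable_heatAverage :
    Measurable fun p : EuclideanSpace ℝ (Fin n) × ℝ => heatAverage ν p.2 p.1 := by
  refine (StronglyMeasurable.integral_prod_right' (ν := ν)
    (f := fun q : (EuclideanSpace ℝ (Fin n) × ℝ) × EuclideanSpace ℝ (Fin n) =>
      heatKernel q.1.2 (q.1.1 - q.2)) ?_).measurable
  exact (measurable_heatKernel.comp (by fun_prop : Measurable fun
    q : (EuclideanSpace ℝ (Fin n) × ℝ) × EuclideanSpace ℝ (Fin n) =>
      (q.1.2, q.1.1 - q.2))).stronglyMeasurable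

lemma measurable_heatGradient :
    Measurable fun p : EuclideanSpace ℝ (Fin n) × ℝ => heatGradient ν p.2 p.1 := by
  refine (StronglyMeasurable.integral_prod_right' (ν := ν)
    (f := fun q : (EuclideanSpace ℝ (Fin n) × ℝ) × EuclideanSpace ℝ (Fin n) =>
      (-(2 / q.1.2 ^ 2) * heatKernel q.1.2 (q.1.1 - q.2)) • (q.1.1 - q.2)) ?_).measurable
  have := (measurable_heatKernel (n := n)).comp (by fun_prop : Measurable fun
    q : (EuclideanSpace ℝ (Fin n) × ℝ) × EuclideanSpace ℝ (Fin n) => (q.1.2, q.1.1 - q.2))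
  simp only [Function.comp_def] at this
  apply Measurable.stronglyMeasurable
  fun_prop

lemma measurable_heatScaleDeriv :
    Measurable fun p : EuclideanSpace ℝ (Fin n) × ℝ => heatScaleDeriv ν p.2 p.1 := by
  refine (StronglyMeasurable.integral_prod_right' (ν := ν)
    (f := fun q : (EuclideanSpace ℝ (Fin n) × ℝ) × EuclideanSpace ℝ (Fin n) =>
      (-(n / q.1.2) + 2 / q.1.2 * (‖q.1.1 - q.2‖ / q.1.2) ^ 2)
        * heatKernel q.1.2 (q.1.1 - q.2)) ?_).measurable
  have := (measurable_heatKernel (n := n)).comp (by fun_prop : Measurable fun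
    q : (EuclideanSpace ℝ (Fin n) × ℝ) × EuclideanSpace ℝ (Fin n) => (q.1.2, q.1.1 - q.2))
  simp only [Function.comp_def] at this
  apply Measurable.stronglyMeasurable
  fun_prop

end Average

/-! ### Pointwise bounds for derivatives of the kernel by the weighted kernel. -/

section KernelBounds

variable {n : ℕ}

lemma heatKernel_le_sq_mul {r : ℝ} (hr : 0 < r) (z : EuclideanSpace ℝ (Fin n)) :
    heatKernel r z ≤ (1 + ‖z‖ / r) ^ 2 * heatKernel r z := by
  have h0 : 0 ≤ ‖z‖ / r := by positivity
  have := heatKernel_pos hr z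
  nlinarith [sq_nonneg (‖z‖ / r), mul_nonneg h0 this.le, mul_nonneg (sq_nonneg (‖z‖ / r)) this.le]

lemma norm_gradient_heatKernel_le {r : ℝ} (hr : 0 < r) (z : EuclideanSpace ℝ (Fin n)) :
    ‖(-(2 / r ^ 2) * heatKernel r z) • z‖
      ≤ r⁻¹ * ((1 + ‖z‖ / r) ^ 2 * heatKernel r z) := by
  have h0 : 0 ≤ ‖z‖ / r := by positivity
  have h1 := heatKernel_pos hr z
  rw [norm_smul, norm_mul, norm_neg, Real.norm_of_nonneg h1.le,
    Real.norm_of_nonneg (by positivity)]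
  have : 2 / r ^ 2 * heatKernel r z * ‖z‖ = r⁻¹ * (2 * (‖z‖ / r) * heatKernel r z) := by
    field_simp
  rw [this]
  gcongr
  nlinarith [sq_nonneg (‖z‖ / r)]

lemma abs_scaleDeriv_heatKernel_le {r : ℝ} (hr : 0 < r) (z : EuclideanSpace ℝ (Fin n)) :
    |(-(n / r) + 2 / r * (‖z‖ / r) ^ 2) * heatKernel r z|
      ≤ ((n + 2) / r) * ((1 + ‖z‖ / r) ^ 2 * heatKernel r z) := by
  have h0 : 0 ≤ ‖z‖ / r := by positivity
  have h1 := heatKernel_pos hr z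
  rw [abs_mul, abs_of_pos h1, ← mul_assoc]
  gcongr
  set q := ‖z‖ / r
  have hn : (0 : ℝ) ≤ n := by positivity
  have : -(n / r) + 2 / r * q ^ 2 = (-n + 2 * q ^ 2) / r := by ring
  rw [this, abs_div, abs_of_pos hr, div_mul_eq_mul_div]
  gcongr
  rw [abs_le]
  constructor <;> nlinarith [mul_nonneg hn h0, mul_nonneg hn (sq_nonneg q), sq_nonneg q]

end KernelBounds

/-! ### Gaussian averages of doubling measures: Harnack bounds, differentiation, heat equation. -/

section AverageBounds

variable {n : ℕ} {ν : Measure (EuclideanSpace ℝ (Fin n))} {D : ℝ≥0}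
  [IsLocallyFiniteMeasure ν] (h : DoublingBound ν D)
include h

lemma DoublingBound.integrable_of_norm_le {F : Type*} [NormedAddCommGroup F]
    {f : EuclideanSpace ℝ (Fin n) → F}
    (hf : AEStronglyMeasurable f ν) {x : EuclideanSpace ℝ (Fin n)} {r K : ℝ} (hr : 0 < r)
    (hK : ∀ y, ‖f y‖ ≤ K * Real.exp (-(‖x - y‖ / r))) : Integrable f ν :=
  ((h.integrable_exp x hr).const_mul K).mono' hf (Filter.Eventually.of_forall hK)

lemma DoublingBound.integrable_sq_mul_heatKernel {r : ℝ} (hr : 0 < r)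
    (x : EuclideanSpace ℝ (Fin n)) :
    Integrable (fun y => (1 + ‖x - y‖ / r) ^ 2 * heatKernel r (x - y)) ν := by
  refine h.integrable_of_norm_le (Continuous.aestronglyMeasurable ?_) hr (x := x)
    (K := kernelConst n * (r ^ n)⁻¹) ?_
  · have := continuous_heatKernel (n := n) r
    fun_prop
  · intro y
    have := heatKernel_pos hr (x - y)
    rw [Real.norm_of_nonneg (by positivity)]
    exact sq_mul_heatKernel_le hr _

lemma DoublingBound.integrable_heatKernel {r : ℝ} (hr : 0 < r) (x : EuclideanSpace ℝ (Fin n)) :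
    Integrable (fun y => heatKernel r (x - y)) ν := by
  refine (h.integrable_sq_mul_heatKernel hr x).mono' (Continuous.aestronglyMeasurable ?_)
    (Filter.Eventually.of_forall fun y => ?_)
  · have := continuous_heatKernel (n := n) r
    fun_prop
  · rw [Real.norm_of_nonneg (heatKernel_pos hr _).le]
    exact heatKernel_le_sq_mul hr _

lemma DoublingBound.integral_sq_mul_heatKernel_le {r : ℝ} (hr : 0 < r)
    (x : EuclideanSpace ℝ (Fin n)) :
    ∫ y, (1 + ‖x - y‖ / r) ^ 2 * heatKernel r (x - y) ∂ν
      ≤ kernelConst n * expConst D * (r ^ n)⁻¹ * ν.real (ball x r) := by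
  calc _ ≤ ∫ y, kernelConst n * (r ^ n)⁻¹ * Real.exp (-(‖x - y‖ / r)) ∂ν :=
        integral_mono (h.integrable_sq_mul_heatKernel hr x) ((h.integrable_exp x hr).const_mul _)
          fun y => sq_mul_heatKernel_le hr _
    _ = kernelConst n * (r ^ n)⁻¹ * ∫ y, Real.exp (-(‖x - y‖ / r)) ∂ν := integral_const_mul _ _
    _ ≤ kernelConst n * (r ^ n)⁻¹ * (expConst D * ν.real (ball x r)) := by
        have := kernelConst_pos n
        gcongr
        exact h.integral_exp_le x hr
    _ = _ := by ring

lemma DoublingBound.heatAverage_le {r : ℝ} (hr : 0 < r) (x : EuclideanSpace ℝ (Fin n)) :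
    heatAverage ν r x ≤ kernelConst n * expConst D * (r ^ n)⁻¹ * ν.real (ball x r) :=
  (integral_mono (h.integrable_heatKernel hr x) (h.integrable_sq_mul_heatKernel hr x)
    fun _ => heatKernel_le_sq_mul hr _).trans (h.integral_sq_mul_heatKernel_le hr x)

lemma DoublingBound.le_heatAverage {r : ℝ} (hr : 0 < r) (x : EuclideanSpace ℝ (Fin n)) :
    (r ^ n)⁻¹ * (Real.pi ^ (-(n : ℝ) / 2) * Real.exp (-1)) * ν.real (ball x r)
      ≤ heatAverage ν r x := by
  calc _ = ∫ y in ball x r, (r ^ n)⁻¹ * (Real.pi ^ (-(n : ℝ) / 2) * Real.exp (-1)) ∂ν := by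
        rw [setIntegral_const, smul_eq_mul, mul_comm]
    _ ≤ ∫ y in ball x r, heatKernel r (x - y) ∂ν := by
        refine setIntegral_mono_on ?_ (h.integrable_heatKernel hr x).integrableOn
          measurableSet_ball fun _ hy => le_heatKernel hr ?_
        · exact integrableOn_const (measure_ball_lt_top' x r).ne
        · rw [← dist_eq_norm]
          exact (mem_ball'.1 hy).le
    _ ≤ ∫ y, heatKernel r (x - y) ∂ν :=
        setIntegral_le_integral (h.integrable_heatKernel hr x)
          (Filter.Eventually.of_forall fun y => (heatKernel_pos hr _).le)

lemma DoublingBound.heatAverage_pos (hν : ν ≠ 0) {r : ℝ} (hr : 0 < r)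
    (x : EuclideanSpace ℝ (Fin n)) : 0 < heatAverage ν r x := by
  refine lt_of_lt_of_le ?_ (h.le_heatAverage hr x)
  have := h.ball_real_pos hν x hr
  positivity

/-- The Harnack type constant attached to a doubling constant. -/
noncomputable def harnackConst (D : ℝ≥0) : ℝ := Real.exp 4 * expConst D

omit h in
lemma harnackConst_nonneg (D : ℝ≥0) : 0 ≤ harnackConst D := by
  unfold harnackConst
  positivity

/-- Both sides are comparable to `r^{-n} ν(B(x,r))`; the constants `e³` above and `e^{-1}` below
explain the `e⁴` in `harnackConst`. Every derivative of `u` is thereby controlled by `u` times the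
appropriate power of `1/r`. -/
lemma DoublingBound.integral_sq_mul_heatKernel_le_heatAverage {r : ℝ} (hr : 0 < r)
    (x : EuclideanSpace ℝ (Fin n)) :
    ∫ y, (1 + ‖x - y‖ / r) ^ 2 * heatKernel r (x - y) ∂ν
      ≤ harnackConst D * heatAverage ν r x := by
  refine (h.integral_sq_mul_heatKernel_le hr x).trans ?_
  have h1 := mul_le_mul_of_nonneg_left (h.le_heatAverage hr x) (harnackConst_nonneg D)
  refine le_trans (le_of_eq ?_) h1
  unfold kernelConst harnackConst
  have : Real.exp 4 * Real.exp (-1) = Real.exp 3 := by rw [← Real.exp_add]; norm_num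
  rw [← this]
  ring

lemma DoublingBound.norm_heatGradient_le {r : ℝ} (hr : 0 < r) (x : EuclideanSpace ℝ (Fin n)) :
    ‖heatGradient ν r x‖ ≤ harnackConst D / r * heatAverage ν r x := by
  unfold heatGradient
  calc _ ≤ ∫ y, r⁻¹ * ((1 + ‖x - y‖ / r) ^ 2 * heatKernel r (x - y)) ∂ν :=
        norm_integral_le_of_norm_le ((h.integrable_sq_mul_heatKernel hr x).const_mul _)
          (Filter.Eventually.of_forall fun y => norm_gradient_heatKernel_le hr _)
    _ = r⁻¹ * ∫ y, (1 + ‖x - y‖ / r) ^ 2 * heatKernel r (x - y) ∂ν := integral_const_mul _ _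
    _ ≤ r⁻¹ * (harnackConst D * heatAverage ν r x) := by
        gcongr
        exact h.integral_sq_mul_heatKernel_le_heatAverage hr x
    _ = _ := by ring

lemma DoublingBound.abs_heatScaleDeriv_le {r : ℝ} (hr : 0 < r) (x : EuclideanSpace ℝ (Fin n)) :
    |heatScaleDeriv ν r x| ≤ (n + 2) * harnackConst D / r * heatAverage ν r x := by
  unfold heatScaleDeriv
  rw [← Real.norm_eq_abs]
  calc _ ≤ ∫ y, (n + 2) / r * ((1 + ‖x - y‖ / r) ^ 2 * heatKernel r (x - y)) ∂ν :=
        norm_integral_le_of_norm_le ((h.integrable_sq_mul_heatKernel hr x).const_mul _)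
          (Filter.Eventually.of_forall fun y => abs_scaleDeriv_heatKernel_le hr _)
    _ = (n + 2) / r * ∫ y, (1 + ‖x - y‖ / r) ^ 2 * heatKernel r (x - y) ∂ν :=
        integral_const_mul _ _
    _ ≤ (n + 2) / r * (harnackConst D * heatAverage ν r x) := by
        gcongr
        exact h.integral_sq_mul_heatKernel_le_heatAverage hr x
    _ = _ := by ring

omit h [IsLocallyFiniteMeasure ν] in
lemma sq_mul_heatKernel_le_of_mem_ball {r : ℝ} (hr : 0 < r) {x x₀ : EuclideanSpace ℝ (Fin n)}
    (hx : x ∈ ball x₀ r) (y : EuclideanSpace ℝ (Fin n)) :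
    (1 + ‖x - y‖ / r) ^ 2 * heatKernel r (x - y)
      ≤ kernelConst n * (r ^ n)⁻¹ * Real.exp 1 * Real.exp (-(‖x₀ - y‖ / r)) := by
  refine (sq_mul_heatKernel_le hr _).trans ?_
  rw [mul_assoc _ (Real.exp 1)]
  have := kernelConst_pos n
  gcongr
  exact exp_neg_norm_sub_le hr hx y

lemma DoublingBound.hasFDerivAt_heatAverage {r : ℝ} (hr : 0 < r) (x : EuclideanSpace ℝ (Fin n)) :
    HasFDerivAt (heatAverage ν r) (innerSL ℝ (heatGradient ν r x)) x := by
  have hc := continuous_heatKernel (n := n) r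
  have hint : Integrable (fun y => (-(2 / r ^ 2) * heatKernel r (x - y)) • (x - y)) ν := by
    refine ((h.integrable_sq_mul_heatKernel hr x).const_mul r⁻¹).mono'
      (Continuous.aestronglyMeasurable (by fun_prop))
      (Filter.Eventually.of_forall fun y => norm_gradient_heatKernel_le hr _)
  have key := hasFDerivAt_integral_of_dominated_of_fderiv_le (μ := ν) (𝕜 := ℝ)
    (F := fun x y => heatKernel r (x - y)) (x₀ := x) (s := ball x r)
    (F' := fun x y => innerSL ℝ ((-(2 / r ^ 2) * heatKernel r (x - y)) • (x - y)))
    (bound := fun y => r⁻¹ * (kernelConst n * (r ^ n)⁻¹ * Real.exp 1)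
      * Real.exp (-(‖x - y‖ / r)))
    (ball_mem_nhds x hr)
    (Filter.Eventually.of_forall fun x => Continuous.aestronglyMeasurable (by fun_prop))
    (h.integrable_heatKernel hr x)
    (Continuous.aestronglyMeasurable (by fun_prop))
    (Filter.Eventually.of_forall fun y x' hx' => by
      rw [innerSL_apply_norm]
      refine (norm_gradient_heatKernel_le hr _).trans ?_
      rw [mul_assoc]
      exact mul_le_mul_of_nonneg_left (sq_mul_heatKernel_le_of_mem_ball hr hx' y)
        (by positivity))
    ((h.integrable_exp x hr).const_mul _)
    (Filter.Eventually.of_forall fun y x' _ => by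
      have := (hasFDerivAt_heatKernel (r := r) (x' - y)).comp x' ((hasFDerivAt_id x').sub_const y)
      simpa [Function.comp_def] using this)
  refine key.congr_fderiv ?_
  unfold heatGradient
  exact (innerSL ℝ).integral_comp_comm hint

lemma DoublingBound.hasDerivAt_heatAverage {r : ℝ} (hr : 0 < r) (x : EuclideanSpace ℝ (Fin n)) :
    HasDerivAt (fun s => heatAverage ν s x) (heatScaleDeriv ν r x) r := by
  have hc := fun s => continuous_heatKernel (n := n) s
  -- Scales stay in `(r/2, 2r)`, so one function dominates: the prefactors are largest at `r/2`, the
  -- exponential at `2r`.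
  refine (hasDerivAt_integral_of_dominated_loc_of_deriv_le (μ := ν) (𝕜 := ℝ)
    (F := fun s y => heatKernel s (x - y)) (x₀ := r) (s := Set.Ioo (r / 2) (2 * r))
    (F' := fun s y => (-(n / s) + 2 / s * (‖x - y‖ / s) ^ 2) * heatKernel s (x - y))
    (bound := fun y => ((n + 2) / (r / 2) * (kernelConst n * ((r / 2) ^ n)⁻¹))
      * Real.exp (-(‖x - y‖ / (2 * r))))
    (Ioo_mem_nhds (by linarith) (by linarith))
    (Filter.Eventually.of_forall fun s => Continuous.aestronglyMeasurable ?_)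
    (h.integrable_heatKernel hr x)
    (Continuous.aestronglyMeasurable ?_)
    (Filter.Eventually.of_forall fun y s hs => ?_)
    ((h.integrable_exp x (by positivity)).const_mul _)
    (Filter.Eventually.of_forall fun y s hs => ?_)).2
  · have := hc s
    fun_prop
  · have := hc r
    fun_prop
  · have hs0 : 0 < s := by linarith [hs.1]
    refine (abs_scaleDeriv_heatKernel_le hs0 _).trans ?_
    rw [mul_assoc ((n + 2) / (r / 2) : ℝ)]
    have h1 := sq_mul_heatKernel_le hs0 (x - y)
    have h2 := kernelConst_pos n
    have h3 := heatKernel_pos hs0 (x - y)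
    calc _ ≤ (n + 2) / s * (kernelConst n * (s ^ n)⁻¹ * Real.exp (-(‖x - y‖ / s))) := by gcongr
      _ ≤ _ := by
        gcongr
        exacts [hs.1.le, hs.1.le, hs.2.le]
  · exact hasDerivAt_heatKernel (by linarith [hs.1]) _

/-- The derivative of a component of `heatGradient` in the direction of this component. -/
noncomputable def heatLineDeriv (ν : Measure (EuclideanSpace ℝ (Fin n))) (r : ℝ)
    (e x : EuclideanSpace ℝ (Fin n)) : ℝ :=
  ∫ y, -(2 / r ^ 2) * (1 - 2 / r ^ 2 * inner ℝ e (x - y) ^ 2) * heatKernel r (x - y) ∂ν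

omit h [IsLocallyFiniteMeasure ν] in
lemma abs_lineDeriv_heatKernel_le {r : ℝ} (hr : 0 < r) {e : EuclideanSpace ℝ (Fin n)}
    (he : ‖e‖ = 1) (z : EuclideanSpace ℝ (Fin n)) :
    |-(2 / r ^ 2) * (1 - 2 / r ^ 2 * inner ℝ e z ^ 2) * heatKernel r z|
      ≤ 4 / r ^ 2 * ((1 + ‖z‖ / r) ^ 2 * heatKernel r z) := by
  have h1 := heatKernel_pos hr z
  have h0 : 0 ≤ ‖z‖ / r := by positivity
  have h2 : inner ℝ e z ^ 2 / r ^ 2 ≤ (‖z‖ / r) ^ 2 := by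
    rw [div_pow]
    have := abs_real_inner_le_norm e z
    rw [he, one_mul] at this
    exact div_le_div_of_nonneg_right (sq_le_sq' (abs_le.1 this).1 (abs_le.1 this).2)
      (by positivity)
  have h3 : 0 ≤ inner ℝ e z ^ 2 / r ^ 2 := by positivity
  have h4 : 2 / r ^ 2 * inner ℝ e z ^ 2 = 2 * (inner ℝ e z ^ 2 / r ^ 2) := by ring
  rw [abs_mul, abs_of_pos h1, ← mul_assoc, h4, abs_mul, abs_neg,
    abs_of_nonneg (by positivity : 0 ≤ 2 / r ^ 2),
    (by ring : 4 / r ^ 2 * (1 + ‖z‖ / r) ^ 2 = 2 / r ^ 2 * (2 * (1 + ‖z‖ / r) ^ 2))]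
  gcongr
  rw [abs_le]
  constructor <;> nlinarith

lemma DoublingBound.integrable_lineDeriv {r : ℝ} (hr : 0 < r) {e : EuclideanSpace ℝ (Fin n)}
    (he : ‖e‖ = 1) (x : EuclideanSpace ℝ (Fin n)) :
    Integrable (fun y => -(2 / r ^ 2) * (1 - 2 / r ^ 2 * inner ℝ e (x - y) ^ 2)
      * heatKernel r (x - y)) ν := by
  have hc := continuous_heatKernel (n := n) r
  exact ((h.integrable_sq_mul_heatKernel hr x).const_mul (4 / r ^ 2)).mono'
    (Continuous.aestronglyMeasurable (by fun_prop))
    (Filter.Eventually.of_forall fun y => abs_lineDeriv_heatKernel_le hr he _)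

lemma DoublingBound.abs_heatLineDeriv_le {r : ℝ} (hr : 0 < r) {e : EuclideanSpace ℝ (Fin n)}
    (he : ‖e‖ = 1) (x : EuclideanSpace ℝ (Fin n)) :
    |heatLineDeriv ν r e x| ≤ 4 * harnackConst D / r ^ 2 * heatAverage ν r x := by
  unfold heatLineDeriv
  rw [← Real.norm_eq_abs]
  calc _ ≤ ∫ y, 4 / r ^ 2 * ((1 + ‖x - y‖ / r) ^ 2 * heatKernel r (x - y)) ∂ν :=
        norm_integral_le_of_norm_le ((h.integrable_sq_mul_heatKernel hr x).const_mul _)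
          (Filter.Eventually.of_forall fun y => abs_lineDeriv_heatKernel_le hr he _)
    _ = 4 / r ^ 2 * ∫ y, (1 + ‖x - y‖ / r) ^ 2 * heatKernel r (x - y) ∂ν :=
        integral_const_mul _ _
    _ ≤ 4 / r ^ 2 * (harnackConst D * heatAverage ν r x) := by
        gcongr
        exact h.integral_sq_mul_heatKernel_le_heatAverage hr x
    _ = _ := by ring

lemma DoublingBound.integrable_gradient {r : ℝ} (hr : 0 < r) (x : EuclideanSpace ℝ (Fin n)) :
    Integrable (fun y => (-(2 / r ^ 2) * heatKernel r (x - y)) • (x - y)) ν := by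
  have hc := continuous_heatKernel (n := n) r
  exact ((h.integrable_sq_mul_heatKernel hr x).const_mul r⁻¹).mono'
    (Continuous.aestronglyMeasurable (by fun_prop))
    (Filter.Eventually.of_forall fun y => norm_gradient_heatKernel_le hr _)

lemma DoublingBound.inner_heatGradient {r : ℝ} (hr : 0 < r) (e x : EuclideanSpace ℝ (Fin n)) :
    inner ℝ e (heatGradient ν r x)
      = ∫ y, -(2 / r ^ 2) * heatKernel r (x - y) * inner ℝ e (x - y) ∂ν := by
  unfold heatGradient
  rw [← integral_inner (h.integrable_gradient hr x)]
  simp [inner_smul_right]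

lemma DoublingBound.hasLineDerivAt_inner_heatGradient {r : ℝ} (hr : 0 < r)
    {e : EuclideanSpace ℝ (Fin n)} (he : ‖e‖ = 1) (x : EuclideanSpace ℝ (Fin n)) :
    HasLineDerivAt ℝ (fun x => inner ℝ e (heatGradient ν r x)) (heatLineDeriv ν r e x) x e := by
  have hc := continuous_heatKernel (n := n) r
  simp only [h.inner_heatGradient hr]
  unfold HasLineDerivAt heatLineDeriv
  have key := (hasDerivAt_integral_of_dominated_loc_of_deriv_le (μ := ν) (𝕜 := ℝ)
    (F := fun t y => -(2 / r ^ 2) * heatKernel r (x + t • e - y) * inner ℝ e (x + t • e - y))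
    (x₀ := 0) (s := ball 0 r)
    (F' := fun t y => -(2 / r ^ 2) * (1 - 2 / r ^ 2 * inner ℝ e (x + t • e - y) ^ 2)
      * heatKernel r (x + t • e - y))
    (bound := fun y => (4 / r ^ 2 * (kernelConst n * (r ^ n)⁻¹ * Real.exp 1))
      * Real.exp (-(‖x - y‖ / r)))
    (ball_mem_nhds _ hr)
    (Filter.Eventually.of_forall fun s => Continuous.aestronglyMeasurable (by fun_prop))
    ?_
    (Continuous.aestronglyMeasurable (by fun_prop))
    (Filter.Eventually.of_forall fun y t ht => ?_)
    ((h.integrable_exp x hr).const_mul _)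
    (Filter.Eventually.of_forall fun y t ht => ?_)).2
  · simpa using key
  · have := (h.integrable_gradient hr x).const_inner (𝕜 := ℝ) e
    simpa [inner_smul_right] using this
  · refine (abs_lineDeriv_heatKernel_le hr he _).trans ?_
    rw [mul_assoc (4 / r ^ 2)]
    refine mul_le_mul_of_nonneg_left (sq_mul_heatKernel_le_of_mem_ball hr ?_ y) (by positivity)
    simpa [mem_ball, dist_eq_norm, norm_smul, he] using ht
  · have h1 : HasDerivAt (fun t : ℝ => x + t • e - y) e t := by
      simpa using (((hasDerivAt_id t).smul_const e).const_add x).sub_const y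
    have h2 := (hasFDerivAt_heatKernel (r := r) (x + t • e - y)).comp_hasDerivAt t h1
    have h3 : HasDerivAt (fun t : ℝ => inner ℝ e (x + t • e - y)) (inner ℝ e e) t :=
      (innerSL ℝ e).hasFDerivAt.comp_hasDerivAt t h1
    refine ((h2.const_mul (-(2 / r ^ 2))).mul h3).congr_deriv ?_
    rw [real_inner_self_eq_norm_sq, he, innerSL_apply_apply, real_inner_smul_left,
      real_inner_comm]
    simp only [Function.comp_apply]
    ring

/-- The heat equation `Δu = (2/r) ∂_r u`, which already holds for the kernel under the integral. -/
lemma DoublingBound.sum_heatLineDeriv {r : ℝ} (hr : 0 < r) (x : EuclideanSpace ℝ (Fin n)) :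
    ∑ i, heatLineDeriv ν r (EuclideanSpace.basisFun (Fin n) ℝ i) x
      = 2 / r * heatScaleDeriv ν r x := by
  unfold heatLineDeriv heatScaleDeriv
  rw [← integral_finsetSum _ fun i _ => h.integrable_lineDeriv hr
    ((EuclideanSpace.basisFun (Fin n) ℝ).norm_eq_one i) x, ← integral_const_mul]
  congr 1
  ext y
  rw [← Finset.sum_mul, ← Finset.mul_sum, Finset.sum_sub_distrib, ← Finset.mul_sum]
  have := (EuclideanSpace.basisFun (Fin n) ℝ).sum_sq_norm_inner_right (x - y)
  simp only [Real.norm_eq_abs, sq_abs] at this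
  rw [this]
  simp
  field_simp
  ring

end AverageBounds

/-! ### The logarithm of the Gaussian average. -/

section LogAverage

variable {n : ℕ} (ν : Measure (EuclideanSpace ℝ (Fin n)))

/-- The gradient of the logarithm of the Gaussian average of a measure. -/
noncomputable def logGradient (r : ℝ) (x : EuclideanSpace ℝ (Fin n)) :
    EuclideanSpace ℝ (Fin n) :=
  (heatAverage ν r x)⁻¹ • heatGradient ν r x

lemma measurable_logGradient [SFinite ν] :
    Measurable fun p : EuclideanSpace ℝ (Fin n) × ℝ => logGradient ν p.2 p.1 :=
  (measurable_heatAverage ν).inv.smul (measurable_heatGradient ν)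

lemma measurable_heatLineDeriv [SFinite ν] (r : ℝ) (e : EuclideanSpace ℝ (Fin n)) :
    Measurable (heatLineDeriv ν r e) := by
  refine (StronglyMeasurable.integral_prod_right' (ν := ν)
    (f := fun q : EuclideanSpace ℝ (Fin n) × EuclideanSpace ℝ (Fin n) =>
      -(2 / r ^ 2) * (1 - 2 / r ^ 2 * inner ℝ e (q.1 - q.2) ^ 2)
        * heatKernel r (q.1 - q.2)) ?_).measurable
  have := continuous_heatKernel (n := n) r
  apply Continuous.stronglyMeasurable
  fun_prop

variable {ν} {D : ℝ≥0} [IsLocallyFiniteMeasure ν] (h : DoublingBound ν D) (hν : ν ≠ 0)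
include h hν

lemma DoublingBound.hasFDerivAt_log_heatAverage {r : ℝ} (hr : 0 < r)
    (x : EuclideanSpace ℝ (Fin n)) :
    HasFDerivAt (fun x => Real.log (heatAverage ν r x)) (innerSL ℝ (logGradient ν r x)) x := by
  refine ((h.hasFDerivAt_heatAverage hr x).log (h.heatAverage_pos hν hr x).ne').congr_fderiv ?_
  unfold logGradient
  rw [map_smul]

lemma DoublingBound.gradient_log_heatAverage {r : ℝ} (hr : 0 < r)
    (x : EuclideanSpace ℝ (Fin n)) :
    ∇ (fun x => Real.log (heatAverage ν r x)) x = logGradient ν r x :=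
  HasGradientAt.gradient (h.hasFDerivAt_log_heatAverage hν hr x)

lemma DoublingBound.continuous_log_heatAverage {r : ℝ} (hr : 0 < r) :
    Continuous fun x => Real.log (heatAverage ν r x) :=
  continuous_iff_continuousAt.2 fun x => (h.hasFDerivAt_log_heatAverage hν hr x).continuousAt

lemma DoublingBound.norm_logGradient_le {r : ℝ} (hr : 0 < r) (x : EuclideanSpace ℝ (Fin n)) :
    ‖logGradient ν r x‖ ≤ harnackConst D / r := by
  have h0 := h.heatAverage_pos hν hr x
  unfold logGradient
  rw [norm_smul, norm_inv, Real.norm_of_nonneg h0.le, inv_mul_le_iff₀ h0, mul_comm]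
  exact h.norm_heatGradient_le hr x

lemma DoublingBound.abs_log_heatAverage_sub_le {r : ℝ} (hr : 0 < r)
    (x y : EuclideanSpace ℝ (Fin n)) :
    |Real.log (heatAverage ν r y) - Real.log (heatAverage ν r x)|
      ≤ harnackConst D / r * ‖y - x‖ :=
  Convex.norm_image_sub_le_of_norm_hasFDerivWithin_le
    (fun x _ => (h.hasFDerivAt_log_heatAverage hν hr x).hasFDerivWithinAt)
    (fun x _ => by
      rw [innerSL_apply_norm]
      exact h.norm_logGradient_le hν hr x) convex_univ (Set.mem_univ x) (Set.mem_univ y)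

lemma DoublingBound.abs_logScaleDeriv_le {r : ℝ} (hr : 0 < r) (x : EuclideanSpace ℝ (Fin n)) :
    |heatScaleDeriv ν r x / heatAverage ν r x| ≤ (n + 2) * harnackConst D / r := by
  have h0 := h.heatAverage_pos hν hr x
  rw [abs_div, abs_of_pos h0, div_le_iff₀ h0]
  exact h.abs_heatScaleDeriv_le hr x

lemma DoublingBound.hasDerivAt_log_heatAverage {r : ℝ} (hr : 0 < r)
    (x : EuclideanSpace ℝ (Fin n)) :
    HasDerivAt (fun s => Real.log (heatAverage ν s x))
      (heatScaleDeriv ν r x / heatAverage ν r x) r :=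
  (h.hasDerivAt_heatAverage hr x).log (h.heatAverage_pos hν hr x).ne'

end LogAverage

/-! ### Evolution in the scale of the logarithm tested against a cutoff. -/

section Evolution

variable {n : ℕ}

lemma Continuous.integrable_mul_of_bounded {k b : EuclideanSpace ℝ (Fin n) → ℝ}
    (hk : Continuous k) (hkc : HasCompactSupport k) (hb : Measurable b) {C : ℝ}
    (hC : ∀ x, |b x| ≤ C) : Integrable (fun x => k x * b x) := by
  have := (hk.integrable_of_hasCompactSupport hkc (μ := volume)).bdd_mul
    hb.aestronglyMeasurable (Filter.Eventually.of_forall hC)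
  simpa [mul_comm] using this

variable {ν : Measure (EuclideanSpace ℝ (Fin n))} {D : ℝ≥0}
  [IsLocallyFiniteMeasure ν] (h : DoublingBound ν D) (hν : ν ≠ 0)
  {ψ : EuclideanSpace ℝ (Fin n) → ℝ} (hψ : ContDiff ℝ 1 ψ) (hψc : HasCompactSupport ψ)
include h hν hψ hψc

/-- Integration by parts of `ψ/u` against `∂_e u`; differentiating `1/u` produces the quadratic
term. -/
lemma DoublingBound.integral_mul_heatLineDeriv {r : ℝ} (hr : 0 < r)
    {e : EuclideanSpace ℝ (Fin n)} (he : ‖e‖ = 1) :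
    Integrable (fun x => ψ x * (heatLineDeriv ν r e x / heatAverage ν r x)) ∧
    Integrable (fun x => fderiv ℝ ψ x e * inner ℝ e (logGradient ν r x)
        - ψ x * inner ℝ e (logGradient ν r x) ^ 2) ∧
    ∫ x, ψ x * (heatLineDeriv ν r e x / heatAverage ν r x)
      = - ∫ x, (fderiv ℝ ψ x e * inner ℝ e (logGradient ν r x)
        - ψ x * inner ℝ e (logGradient ν r x) ^ 2) := by
  have hu := fun x => h.heatAverage_pos hν hr x
  have hmu : Measurable (heatAverage ν r) :=
    (measurable_heatAverage ν).comp (measurable_id.prodMk measurable_const)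
  have hml : Measurable (logGradient ν r) :=
    (measurable_logGradient ν).comp (measurable_id.prodMk measurable_const)
  have hil : ∀ x, |inner ℝ e (logGradient ν r x)| ≤ harnackConst D / r := fun x => by
    refine (abs_real_inner_le_norm _ _).trans ?_
    rw [he, one_mul]
    exact h.norm_logGradient_le hν hr x
  have hψ' : Continuous fun x => fderiv ℝ ψ x e :=
    (hψ.continuous_fderiv one_ne_zero).clm_apply continuous_const
  have hψc' : HasCompactSupport fun x => fderiv ℝ ψ x e := hψc.fderiv_apply (𝕜 := ℝ) e
  have i1 : Integrable (fun x => ψ x * (heatLineDeriv ν r e x / heatAverage ν r x)) := by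
    refine hψ.continuous.integrable_mul_of_bounded hψc
      ((measurable_heatLineDeriv ν r e).div hmu) (C := 4 * harnackConst D / r ^ 2) fun x => ?_
    rw [abs_div, abs_of_pos (hu x), div_le_iff₀ (hu x)]
    exact h.abs_heatLineDeriv_le hr he x
  have i2 : Integrable (fun x => fderiv ℝ ψ x e * inner ℝ e (logGradient ν r x)) :=
    hψ'.integrable_mul_of_bounded hψc' (by fun_prop) hil
  have i3 : Integrable (fun x => ψ x * inner ℝ e (logGradient ν r x) ^ 2) := by
    refine hψ.continuous.integrable_mul_of_bounded hψc (by fun_prop)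
      (C := (harnackConst D / r) ^ 2) fun x => ?_
    rw [abs_pow]
    exact pow_le_pow_left₀ (abs_nonneg _) (hil x) 2
  have i4 : Integrable (fun x => ψ x * inner ℝ e (logGradient ν r x)) :=
    hψ.continuous.integrable_mul_of_bounded hψc (by fun_prop) hil
  have hlg : ∀ x, inner ℝ e (logGradient ν r x)
      = inner ℝ e (heatGradient ν r x) / heatAverage ν r x := fun x => by
    unfold logGradient
    rw [inner_smul_right]
    field_simp
  refine ⟨i1, i2.sub i3, ?_⟩
  have key := integral_bilinear_hasLineDerivAt_right_eq_neg_left_of_integrable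
    (μ := (volume : Measure (EuclideanSpace ℝ (Fin n)))) (v := e) (B := ContinuousLinearMap.mul ℝ ℝ)
    (f := fun x => ψ x / heatAverage ν r x)
    (f' := fun x => (fderiv ℝ ψ x e - ψ x * inner ℝ e (logGradient ν r x)) / heatAverage ν r x)
    (g := fun x => inner ℝ e (heatGradient ν r x)) (g' := heatLineDeriv ν r e)
  simp only [ContinuousLinearMap.mul_apply'] at key
  have e1 : ∀ x, ψ x / heatAverage ν r x * heatLineDeriv ν r e x
      = ψ x * (heatLineDeriv ν r e x / heatAverage ν r x) := fun x => by ring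
  have e2 : ∀ x, (fderiv ℝ ψ x e - ψ x * inner ℝ e (logGradient ν r x)) / heatAverage ν r x
        * inner ℝ e (heatGradient ν r x)
      = fderiv ℝ ψ x e * inner ℝ e (logGradient ν r x)
        - ψ x * inner ℝ e (logGradient ν r x) ^ 2 := fun x => by
    rw [hlg]
    ring
  have e3 : ∀ x, ψ x / heatAverage ν r x * inner ℝ e (heatGradient ν r x)
      = ψ x * inner ℝ e (logGradient ν r x) := fun x => by
    rw [hlg]
    ring
  simp only [e1, e2, e3] at key
  refine key (i2.sub i3) i1 i4 (fun x _ => ?_)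
    (fun x _ => h.hasLineDerivAt_inner_heatGradient hr he x)
  have d1 : HasFDerivAt ψ (fderiv ℝ ψ x) x :=
    (hψ.differentiable one_ne_zero x).hasFDerivAt
  have d2 := d1.hasLineDerivAt e
  have d3 := (h.hasFDerivAt_heatAverage hr x).hasLineDerivAt e
  unfold HasLineDerivAt at d2 d3 ⊢
  refine (d2.fun_div d3 (by simpa using (hu x).ne')).congr_deriv ?_
  rw [hlg]
  simp only [zero_smul, add_zero, innerSL_apply_apply]
  rw [real_inner_comm e]
  have := (hu x).ne'
  field_simp

/-- Summing over an orthonormal basis turns the Laplacian into the scale derivative. What remains is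
the Carleson density, up to a factor, and a term supported where `∇ψ ≠ 0`. -/
lemma DoublingBound.integral_mul_logScaleDeriv {r : ℝ} (hr : 0 < r) :
    Integrable (fun x => ψ x * ‖logGradient ν r x‖ ^ 2 - fderiv ℝ ψ x (logGradient ν r x)) ∧
    ∫ x, ψ x * (heatScaleDeriv ν r x / heatAverage ν r x)
      = r / 2 * ∫ x, (ψ x * ‖logGradient ν r x‖ ^ 2 - fderiv ℝ ψ x (logGradient ν r x)) := by
  set b := EuclideanSpace.basisFun (Fin n) ℝ
  have H := fun i => h.integral_mul_heatLineDeriv hν hψ hψc hr (b.norm_eq_one i)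
  have e1 : ∀ x, ψ x * (heatScaleDeriv ν r x / heatAverage ν r x)
      = r / 2 * ∑ i, ψ x * (heatLineDeriv ν r (b i) x / heatAverage ν r x) := fun x => by
    rw [← Finset.mul_sum, ← Finset.sum_div, h.sum_heatLineDeriv hr]
    field_simp
  have e2 : ∀ x, ψ x * ‖logGradient ν r x‖ ^ 2 - fderiv ℝ ψ x (logGradient ν r x)
      = - ∑ i, (fderiv ℝ ψ x (b i) * inner ℝ (b i) (logGradient ν r x)
        - ψ x * inner ℝ (b i) (logGradient ν r x) ^ 2) := fun x => by
    rw [Finset.sum_sub_distrib, ← Finset.mul_sum]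
    have h1 := b.sum_sq_norm_inner_right (logGradient ν r x)
    simp only [Real.norm_eq_abs, sq_abs] at h1
    have h2 : fderiv ℝ ψ x (logGradient ν r x)
        = ∑ i, fderiv ℝ ψ x (b i) * inner ℝ (b i) (logGradient ν r x) := by
      conv_lhs => rw [← b.sum_repr' (logGradient ν r x)]
      rw [map_sum]
      simp [mul_comm]
    rw [h1, h2]
    ring
  simp only [e1, e2]
  refine ⟨(integrable_finsetSum _ fun i _ => (H i).2.1).neg, ?_⟩
  rw [integral_const_mul, integral_neg, integral_finsetSum _ fun i _ => (H i).1,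
    integral_finsetSum _ fun i _ => (H i).2.1, Finset.sum_congr rfl fun i _ => (H i).2.2,
    Finset.sum_neg_distrib]

omit hψ in
lemma DoublingBound.hasDerivAt_integral_mul_log (hψ : Continuous ψ) {r : ℝ} (hr : 0 < r) :
    HasDerivAt (fun s => ∫ x, ψ x * Real.log (heatAverage ν s x))
      (∫ x, ψ x * (heatScaleDeriv ν r x / heatAverage ν r x)) r := by
  have hm : ∀ s, Measurable fun x => heatScaleDeriv ν s x / heatAverage ν s x := fun s =>
    ((measurable_heatScaleDeriv ν).comp (measurable_id.prodMk measurable_const)).div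
      ((measurable_heatAverage ν).comp (measurable_id.prodMk measurable_const))
  have hm' : ∀ s, Measurable fun x => Real.log (heatAverage ν s x) := fun s =>
    ((measurable_heatAverage ν).comp (measurable_id.prodMk measurable_const)).log
  refine (hasDerivAt_integral_of_dominated_loc_of_deriv_le (𝕜 := ℝ)
    (F := fun s x => ψ x * Real.log (heatAverage ν s x)) (x₀ := r) (s := Set.Ioi (r / 2))
    (F' := fun s x => ψ x * (heatScaleDeriv ν s x / heatAverage ν s x))
    (bound := fun x => ‖ψ x‖ * ((n + 2) * harnackConst D / (r / 2)))
    (Ioi_mem_nhds (by linarith))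
    (Filter.Eventually.of_forall fun s => (hψ.measurable.mul (hm' s)).aestronglyMeasurable)
    ?_ (hψ.measurable.mul (hm r)).aestronglyMeasurable
    (Filter.Eventually.of_forall fun x s hs => ?_) ?_
    (Filter.Eventually.of_forall fun x s hs => ?_)).2
  · exact (hψ.mul (h.continuous_log_heatAverage hν hr)).integrable_of_hasCompactSupport
      hψc.mul_right
  · have hs' : r / 2 < s := hs
    have hs0 : 0 < s := by linarith
    rw [norm_mul]
    gcongr
    refine (h.abs_logScaleDeriv_le hν hs0 x).trans ?_
    have := harnackConst_nonneg D
    gcongr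
  · exact (hψ.integrable_of_hasCompactSupport hψc).norm.mul_const _
  · have hs' : r / 2 < s := hs
    exact (h.hasDerivAt_log_heatAverage hν (by linarith) x).const_mul _

end Evolution

/-! ### Consequences of the Carleson condition: decay along scales and oscillation at one scale. -/

section Carleson

variable {n : ℕ}

/-- The Carleson condition with constant `δ` for the measure `|∇ log (ν * φ_s)|² s dx ds`, written
with iterated integrals. -/
def CarlesonBound (ν : Measure (EuclideanSpace ℝ (Fin n))) (δ : ℝ) : Prop :=
  ∀ (x : EuclideanSpace ℝ (Fin n)) (R : ℝ), 0 < R →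
    IntegrableOn (fun s => ∫ y in ball x R, ‖logGradient ν s y‖ ^ 2 * s) (Set.Ioo 0 R) ∧
    ∫ s in Set.Ioo 0 R, (∫ y in ball x R, ‖logGradient ν s y‖ ^ 2 * s)
      ≤ δ * volume.real (ball x R)

variable {ν : Measure (EuclideanSpace ℝ (Fin n))} {D : ℝ≥0}
  [IsLocallyFiniteMeasure ν] (h : DoublingBound ν D) (hν : ν ≠ 0)

omit [IsLocallyFiniteMeasure ν] in
-- A mean value argument over `(T/2, T)`: the weight `s ≥ T/2` and the length `T/2` of the interval
-- each give a factor `2/T`.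
lemma CarlesonBound.exists_scale {δ : ℝ} (hC : CarlesonBound ν δ)
    (x : EuclideanSpace ℝ (Fin n)) {R T : ℝ} (hT : 0 < T) (hTR : T ≤ R) :
    ∃ σ ∈ Set.Ioo (T / 2) T,
      ∫ y in ball x R, ‖logGradient ν σ y‖ ^ 2 ≤ 4 * δ / T ^ 2 * volume.real (ball x R) := by
  obtain ⟨h1, h2⟩ := hC x R (hT.trans_le hTR)
  set f := fun s => ∫ y in ball x R, ‖logGradient ν s y‖ ^ 2 * s with hf
  have hsub : Set.Ioo (T / 2) T ⊆ Set.Ioo 0 R := Set.Ioo_subset_Ioo (by linarith) hTR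
  have hvol : volume (Set.Ioo (T / 2) T) = ENNReal.ofReal (T / 2) := by
    rw [Real.volume_Ioo]
    congr 1
    ring
  obtain ⟨σ, hσ, hle⟩ := exists_le_setAverage (μ := volume) (s := Set.Ioo (T / 2) T) (f := f)
    (by rw [hvol]; simpa using by linarith) (by rw [hvol]; simp) (h1.mono_set hsub)
  refine ⟨σ, hσ, ?_⟩
  have hσ0 : T / 2 < σ := hσ.1
  have h3 : ∫ s in Set.Ioo (T / 2) T, f s ≤ δ * volume.real (ball x R) := by
    refine le_trans (setIntegral_mono_set h1 ?_ hsub.eventuallyLE) h2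
    refine (ae_restrict_iff' measurableSet_Ioo).2 (Filter.Eventually.of_forall fun s hs => ?_)
    exact integral_nonneg fun y => mul_nonneg (by positivity) hs.1.le
  rw [setAverage_eq, measureReal_def, hvol, ENNReal.toReal_ofReal (by linarith),
    smul_eq_mul] at hle
  have h4 : f σ = (∫ y in ball x R, ‖logGradient ν σ y‖ ^ 2) * σ := integral_mul_const _ _
  have h5 : 0 ≤ ∫ y in ball x R, ‖logGradient ν σ y‖ ^ 2 :=
    integral_nonneg fun y => by positivity
  have h6 : (∫ y in ball x R, ‖logGradient ν σ y‖ ^ 2) * (T / 2)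
      ≤ (T / 2)⁻¹ * (δ * volume.real (ball x R)) := by
    calc _ ≤ f σ := by rw [h4]; gcongr
      _ ≤ _ := hle.trans (by gcongr)
  rw [← le_div_iff₀ (by positivity)] at h6
  refine h6.trans (le_of_eq ?_)
  field_simp
  ring

include h hν

lemma DoublingBound.integrableOn_norm_logGradient_pow {r : ℝ} (hr : 0 < r) (k : ℕ)
    (x : EuclideanSpace ℝ (Fin n)) (R : ℝ) :
    IntegrableOn (fun y => ‖logGradient ν r y‖ ^ k) (ball x R) := by
  have hml : Measurable (logGradient ν r) :=
    (measurable_logGradient ν).comp (measurable_id.prodMk measurable_const)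
  refine Measure.integrableOn_of_bounded (M := (harnackConst D / r) ^ k) measure_ball_lt_top.ne
    (by fun_prop) (Filter.Eventually.of_forall fun y => ?_)
  rw [norm_pow, norm_norm]
  exact pow_le_pow_left₀ (norm_nonneg _) (h.norm_logGradient_le hν hr y) k

/-- The term linear in `∇ψ` is split by Young's inequality into `|∇ log u|²`, paid for by the
Carleson bound, and `M²`, which is harmless at scales `s ≤ σ`. The independence of `ρ` is what
permits `ρ → 0`. -/
lemma DoublingBound.integral_mul_log_sub_le {δ : ℝ} (hC : CarlesonBound ν δ)
    {ψ : EuclideanSpace ℝ (Fin n) → ℝ} (hψ : ContDiff ℝ 1 ψ) (hψ1 : ∀ x, ψ x ≤ 1)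
    {x : EuclideanSpace ℝ (Fin n)} {R M : ℝ} (hsupp : tsupport ψ ⊆ ball x R)
    (hM : ∀ y, ‖fderiv ℝ ψ y‖ ≤ M) {ρ σ : ℝ} (hρ : 0 < ρ) (hρσ : ρ ≤ σ) (hσ : σ < R) :
    (∫ y, ψ y * Real.log (heatAverage ν σ y)) - ∫ y, ψ y * Real.log (heatAverage ν ρ y)
      ≤ (δ + (σ * M) ^ 2) * volume.real (ball x R) := by
  have hψc : HasCompactSupport ψ := HasCompactSupport.of_support_subset_isCompact
    (isCompact_closedBall x R)
    ((subset_tsupport ψ).trans (hsupp.trans ball_subset_closedBall))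
  have hR : 0 < R := by linarith
  obtain ⟨h1, h2⟩ := hC x R hR
  set f := fun s => ∫ y in ball x R, ‖logGradient ν s y‖ ^ 2 * s with hf
  set V := volume.real (ball x R) with hV
  have hV0 : 0 ≤ V := measureReal_nonneg
  have hIcc : Set.Icc ρ σ ⊆ Set.Ioo 0 R := fun s hs => ⟨by linarith [hs.1], by linarith [hs.2]⟩
  have hderiv : ∀ s ∈ Set.Icc ρ σ, HasDerivAt (fun s => ∫ y, ψ y * Real.log (heatAverage ν s y))
      (∫ y, ψ y * (heatScaleDeriv ν s y / heatAverage ν s y)) s := fun s hs =>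
    h.hasDerivAt_integral_mul_log hν hψc hψ.continuous (hIcc hs).1
  have hle : ∀ s ∈ Set.Ioo ρ σ, ∫ y, ψ y * (heatScaleDeriv ν s y / heatAverage ν s y)
      ≤ f s + σ * M ^ 2 * V := by
    intro s hs
    have hs0 : 0 < s := by linarith [hs.1]
    obtain ⟨i1, e1⟩ := h.integral_mul_logScaleDeriv hν hψ hψc hs0
    rw [e1]
    have i2 : IntegrableOn (fun y => 2 * ‖logGradient ν s y‖ ^ 2 + M ^ 2) (ball x R) :=
      ((h.integrableOn_norm_logGradient_pow hν hs0 2 x R).const_mul 2).add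
        (integrableOn_const measure_ball_lt_top.ne)
    have e2 : ∫ y, (ψ y * ‖logGradient ν s y‖ ^ 2 - fderiv ℝ ψ y (logGradient ν s y))
        ≤ ∫ y in ball x R, (2 * ‖logGradient ν s y‖ ^ 2 + M ^ 2) := by
      rw [← integral_indicator measurableSet_ball]
      refine integral_mono i1 (i2.integrable_indicator measurableSet_ball) fun y => ?_
      by_cases hy : y ∈ ball x R
      · rw [Set.indicator_of_mem hy]
        have a1 : |fderiv ℝ ψ y (logGradient ν s y)| ≤ M * ‖logGradient ν s y‖ :=
          ((fderiv ℝ ψ y).le_opNorm _).trans (by gcongr; exact hM y)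
        have a2 := neg_abs_le (fderiv ℝ ψ y (logGradient ν s y))
        have a3 : ψ y * ‖logGradient ν s y‖ ^ 2 ≤ 1 * ‖logGradient ν s y‖ ^ 2 := by
          gcongr
          exact hψ1 y
        simp only
        nlinarith [sq_nonneg (M - ‖logGradient ν s y‖), sq_nonneg (M + ‖logGradient ν s y‖)]
      · rw [Set.indicator_of_notMem hy]
        have hy' : y ∉ tsupport ψ := fun hy' => hy (hsupp hy')
        have := fderiv_of_notMem_tsupport (𝕜 := ℝ) hy'
        simp [image_eq_zero_of_notMem_tsupport hy', this]
    have e3 : ∫ y in ball x R, (2 * ‖logGradient ν s y‖ ^ 2 + M ^ 2)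
        = 2 * (∫ y in ball x R, ‖logGradient ν s y‖ ^ 2) + M ^ 2 * V := by
      rw [integral_add ((h.integrableOn_norm_logGradient_pow hν hs0 2 x R).const_mul 2)
        (integrableOn_const measure_ball_lt_top.ne), integral_const_mul, setIntegral_const,
        smul_eq_mul, mul_comm V]
    have e4 : f s = (∫ y in ball x R, ‖logGradient ν s y‖ ^ 2) * s := integral_mul_const _ _
    calc _ ≤ s / 2 * (2 * (∫ y in ball x R, ‖logGradient ν s y‖ ^ 2) + M ^ 2 * V) := by
          rw [← e3]
          gcongr
      _ = f s + s / 2 * (M ^ 2 * V) := by rw [e4]; ring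
      _ ≤ f s + σ * (M ^ 2 * V) := by
          gcongr
          linarith [hs.2]
      _ = _ := by ring
  -- This one-sided form of the fundamental theorem asks for integrability of the upper bound only,
  -- not of the derivative.
  have key := intervalIntegral.sub_le_integral_of_hasDeriv_right_of_le hρσ
    (fun s hs => (hderiv s hs).continuousAt.continuousWithinAt)
    (fun s hs => (hderiv s (Set.Ioo_subset_Icc_self hs)).hasDerivWithinAt)
    ((h1.mono_set hIcc).add (integrableOn_const (by simp)))
    hle
  refine key.trans ?_
  have hf1 : IntervalIntegrable f volume ρ σ :=
    (intervalIntegrable_iff_integrableOn_Icc_of_le hρσ).2 (h1.mono_set hIcc)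
  simp only [Pi.add_apply]
  rw [intervalIntegral.integral_add hf1 (by simp), intervalIntegral.integral_const, smul_eq_mul,
    add_mul]
  refine add_le_add ?_ ?_
  · rw [intervalIntegral.integral_of_le hρσ]
    refine le_trans (setIntegral_mono_set h1 ?_
      (Set.Ioc_subset_Icc_self.trans hIcc).eventuallyLE) h2
    refine (ae_restrict_iff' measurableSet_Ioo).2 (Filter.Eventually.of_forall fun s hs => ?_)
    exact integral_nonneg fun y => mul_nonneg (by positivity) hs.1.le
  · have : (σ - ρ) * (σ * M ^ 2 * V) ≤ σ * (σ * M ^ 2 * V) := by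
      have : 0 ≤ σ * M ^ 2 * V := by
        have : 0 ≤ σ := by linarith
        positivity
      gcongr
      linarith
    linarith

/-- A substitute for Poincaré's inequality. The integral `Λ` of `log u_σ` over balls of radius `b`
has gradient at most the `L¹` norm of `∇ log u_σ` on the ball of radius `3R`, and the Harnack bound
keeps `log u_σ` close to its mean over such balls. The free parameter `a` passes from `L¹` to `L²`
through `t ≤ a + t²/a`. -/
lemma DoublingBound.abs_log_sub_le_of_integral_le {x : EuclideanSpace ℝ (Fin n)}
    {R b σ G a : ℝ} (hσ : 0 < σ) (hb : 0 < b) (hbR : b ≤ R) (ha : 0 < a)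
    (hG : ∫ y in ball x (3 * R), ‖logGradient ν σ y‖ ^ 2 ≤ G)
    {y z : EuclideanSpace ℝ (Fin n)} (hy : y ∈ ball x (2 * R)) (hz : z ∈ ball x (2 * R)) :
    |Real.log (heatAverage ν σ y) - Real.log (heatAverage ν σ z)|
      ≤ 2 * (harnackConst D / σ * b)
        + (a * volume.real (ball x (3 * R)) + G / a) * (4 * R)
          / volume.real (ball (0 : EuclideanSpace ℝ (Fin n)) b) := by
  set V := volume.real (ball (0 : EuclideanSpace ℝ (Fin n)) b) with hV
  have hV0 : 0 < V := ENNReal.toReal_pos (measure_ball_pos _ _ hb).ne' measure_ball_lt_top.ne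
  set ℓ := fun y => Real.log (heatAverage ν σ y) with hℓ
  have hℓc : Continuous ℓ := h.continuous_log_heatAverage hν hσ
  have hml : Measurable (logGradient ν σ) :=
    (measurable_logGradient ν).comp (measurable_id.prodMk measurable_const)
  have hℓi : ∀ y, IntegrableOn (fun k => ℓ (y + k)) (ball 0 b) := fun y =>
    ((by fun_prop : Continuous fun k => ℓ (y + k)).continuousOn.integrableOn_compact
      (isCompact_closedBall 0 b)).mono_set ball_subset_closedBall
  set Λ := fun y => ∫ k in ball 0 b, ℓ (y + k) with hΛ
  have hΛd : ∀ y, HasFDerivAt Λ (∫ k in ball 0 b, innerSL ℝ (logGradient ν σ (y + k))) y := by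
    intro y
    refine hasFDerivAt_integral_of_dominated_of_fderiv_le (𝕜 := ℝ)
      (F := fun y k => ℓ (y + k)) (s := Set.univ)
      (F' := fun y k => innerSL ℝ (logGradient ν σ (y + k)))
      (bound := fun _ => harnackConst D / σ) Filter.univ_mem
      (Filter.Eventually.of_forall fun y => Continuous.aestronglyMeasurable (by fun_prop))
      (hℓi y) ?_ (Filter.Eventually.of_forall fun k y _ => ?_)
      (integrableOn_const measure_ball_lt_top.ne)
      (Filter.Eventually.of_forall fun k y _ => ?_)
    · exact ((innerSL ℝ).continuous.measurable.comp
        (hml.comp (measurable_const_add y))).aestronglyMeasurable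
    · rw [innerSL_apply_norm]
      exact h.norm_logGradient_le hν hσ _
    · have := (h.hasFDerivAt_log_heatAverage hν hσ (y + k)).comp y
        ((hasFDerivAt_id y).add_const k)
      simpa [Function.comp_def] using this
  have hΛn : ∀ y ∈ ball x (2 * R), ‖∫ k in ball 0 b, innerSL ℝ (logGradient ν σ (y + k))‖
      ≤ a * volume.real (ball x (3 * R)) + G / a := by
    intro y hy
    have hsub : ball y b ⊆ ball x (3 * R) := ball_subset_ball' (by
      have := mem_ball.1 hy
      linarith)
    have hpre : (fun k => y + k) ⁻¹' ball y b = ball 0 b := by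
      ext k
      simp [mem_ball, dist_eq_norm]
    -- The first power is written `‖·‖ ^ 1` below to match this integrability statement.
    have i1 := h.integrableOn_norm_logGradient_pow hν hσ 1 x (3 * R)
    have i2 := h.integrableOn_norm_logGradient_pow hν hσ 2 x (3 * R)
    calc _ ≤ ∫ k in ball 0 b, ‖innerSL ℝ (logGradient ν σ (y + k))‖ :=
          norm_integral_le_integral_norm _
      _ = ∫ k in (fun k => y + k) ⁻¹' ball y b, ‖logGradient ν σ (y + k)‖ ^ 1 := by
          rw [hpre]
          simp
      _ = ∫ k in ball y b, ‖logGradient ν σ k‖ ^ 1 :=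
          (measurePreserving_add_left volume y).setIntegral_preimage_emb
            (measurableEmbedding_addLeft y) (fun k => ‖logGradient ν σ k‖ ^ 1) _
      _ ≤ ∫ k in ball x (3 * R), ‖logGradient ν σ k‖ ^ 1 :=
          setIntegral_mono_set i1 (Filter.Eventually.of_forall fun k => by positivity)
            hsub.eventuallyLE
      _ ≤ ∫ k in ball x (3 * R), (a + ‖logGradient ν σ k‖ ^ 2 / a) := by
          refine integral_mono i1 ((integrableOn_const measure_ball_lt_top.ne).add
            (i2.div_const a)) fun k => ?_
          simp only [pow_one]
          rw [← sub_le_iff_le_add', le_div_iff₀ ha]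
          nlinarith [sq_nonneg (‖logGradient ν σ k‖ - a), norm_nonneg (logGradient ν σ k)]
      _ = a * volume.real (ball x (3 * R))
            + (∫ k in ball x (3 * R), ‖logGradient ν σ k‖ ^ 2) / a := by
          have i3 : IntegrableOn (fun _ => a) (ball x (3 * R)) volume :=
            integrableOn_const measure_ball_lt_top.ne
          rw [integral_add i3 (i2.div_const a), setIntegral_const, smul_eq_mul, mul_comm,
            integral_div]
      _ ≤ _ := by gcongr
  have hmv : ‖Λ y - Λ z‖ ≤ (a * volume.real (ball x (3 * R)) + G / a) * ‖y - z‖ :=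
    Convex.norm_image_sub_le_of_norm_hasFDerivWithin_le
      (fun y _ => (hΛd y).hasFDerivWithinAt) hΛn (convex_ball x (2 * R)) hz hy
  have hyz : ‖y - z‖ ≤ 4 * R := by
    rw [← dist_eq_norm]
    have := dist_triangle_right y z x
    linarith [mem_ball.1 hy, mem_ball.1 hz]
  have hG0 : 0 ≤ G := (integral_nonneg fun y => by positivity).trans hG
  have hmv' : |Λ y - Λ z| ≤ (a * volume.real (ball x (3 * R)) + G / a) * (4 * R) :=
    hmv.trans (by gcongr)
  have hclose : ∀ y, |Λ y - V * ℓ y| ≤ harnackConst D / σ * b * V := by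
    intro y
    have : Λ y - V * ℓ y = ∫ k in ball 0 b, (ℓ (y + k) - ℓ y) := by
      rw [integral_sub (hℓi y) (integrableOn_const measure_ball_lt_top.ne), setIntegral_const,
        smul_eq_mul]
    rw [this, ← Real.norm_eq_abs]
    refine norm_setIntegral_le_of_norm_le_const measure_ball_lt_top fun k hk => ?_
    refine (h.abs_log_heatAverage_sub_le hν hσ y (y + k)).trans ?_
    have := harnackConst_nonneg D
    rw [mem_ball_zero_iff] at hk
    gcongr
    simpa using hk.le
  have h1 := abs_le.1 (hclose y)
  have h2 := abs_le.1 (hclose z)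
  have h3 := abs_le.1 hmv'
  rw [← sub_le_iff_le_add', le_div_iff₀ hV0]
  have h4 : |ℓ y - ℓ z| * V = |V * ℓ y - V * ℓ z| := by
    rw [← mul_sub, abs_mul, abs_of_pos hV0, mul_comm]
  have h5 : |V * ℓ y - V * ℓ z| ≤ (a * volume.real (ball x (3 * R)) + G / a) * (4 * R)
      + 2 * (harnackConst D / σ * b) * V := abs_le.2 ⟨by linarith, by linarith⟩
  linarith

end Carleson

/-! ### Mass of the kernel, and comparison of `ν(B)` with integrals of Gaussian averages. -/

section Mass

variable {n : ℕ}

lemma integral_heatKernel {r : ℝ} (hr : 0 < r) :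
    ∫ z : EuclideanSpace ℝ (Fin n), heatKernel r z = 1 := by
  have h1 := GaussianFourier.integral_rexp_neg_mul_sq_norm (V := EuclideanSpace ℝ (Fin n))
    (b := (r ^ 2)⁻¹) (by positivity)
  unfold heatKernel
  rw [integral_const_mul, integral_const_mul]
  have h2 : ∀ z : EuclideanSpace ℝ (Fin n),
      Real.exp (-(‖z‖ / r) ^ 2) = Real.exp (-(r ^ 2)⁻¹ * ‖z‖ ^ 2) := fun z => by
    congr 1
    rw [div_pow]
    ring
  simp only [h2, h1, finrank_euclideanSpace, Fintype.card_fin, div_inv_eq_mul]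
  rw [Real.mul_rpow Real.pi_pos.le (by positivity), ← mul_assoc (Real.pi ^ _),
    ← Real.rpow_add Real.pi_pos, neg_div, neg_add_cancel, Real.rpow_zero, one_mul,
    ← Real.rpow_natCast r 2, ← Real.rpow_mul hr.le]
  have : ((2 : ℕ) : ℝ) * ((n : ℝ) / 2) = n := by push_cast; ring
  rw [this, Real.rpow_natCast, inv_mul_cancel₀ (by positivity)]

lemma integrable_heatKernel_volume {r : ℝ} (hr : 0 < r) :
    Integrable (heatKernel r : EuclideanSpace ℝ (Fin n) → ℝ) :=
  Integrable.of_integral_ne_zero (by rw [integral_heatKernel hr]; exact one_ne_zero)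

lemma setIntegral_ball_heatKernel {r : ℝ} (hr : 0 < r) (b : ℝ) :
    ∫ z : EuclideanSpace ℝ (Fin n) in ball 0 b, heatKernel r z
      = ∫ z : EuclideanSpace ℝ (Fin n) in ball 0 (b / r), heatKernel 1 z := by
  have h1 : ∀ z : EuclideanSpace ℝ (Fin n),
      heatKernel r z = (r ^ n)⁻¹ * heatKernel 1 (r⁻¹ • z) := fun z => by
    unfold heatKernel
    rw [norm_smul, norm_inv, Real.norm_of_nonneg hr.le]
    simp [div_eq_inv_mul]
  simp only [h1]
  rw [integral_const_mul, Measure.setIntegral_comp_smul_of_pos _ _ _ (inv_pos.2 hr),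
    _root_.smul_ball (inv_ne_zero hr.ne'), smul_zero, norm_inv, Real.norm_of_nonneg hr.le,
    finrank_euclideanSpace, Fintype.card_fin, smul_eq_mul, inv_pow, inv_inv, ← mul_assoc,
    inv_mul_cancel₀ (by positivity), one_mul, div_eq_inv_mul]

/-- By scaling, the mass in a ball depends on `b / r` only, and it tends to 1 as this ratio grows.
-/
lemma exists_le_setIntegral_heatKernel (n : ℕ) {θ : ℝ} (hθ : θ < 1) :
    ∃ Q : ℝ, 0 < Q ∧ ∀ r b : ℝ, 0 < r → Q * r ≤ b →
      θ ≤ ∫ z : EuclideanSpace ℝ (Fin n) in ball 0 b, heatKernel r z := by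
  have h1 : Filter.Tendsto
      (fun k : ℝ => ∫ z : EuclideanSpace ℝ (Fin n) in ball 0 k, heatKernel 1 z)
      Filter.atTop (nhds 1) := by
    have h0 := AECover.integral_tendsto_of_countably_generated
      (aecover_ball (x := (0 : EuclideanSpace ℝ (Fin n))) (μ := volume) Filter.tendsto_id)
      (integrable_heatKernel_volume one_pos)
    rwa [integral_heatKernel one_pos] at h0
  obtain ⟨Q, hQ, hQ0⟩ := ((h1.eventually_const_lt hθ).and (Filter.eventually_gt_atTop 0)).exists
  refine ⟨Q, hQ0, fun r b hr hb => ?_⟩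
  rw [setIntegral_ball_heatKernel hr]
  refine hQ.le.trans (setIntegral_mono_set (integrable_heatKernel_volume one_pos).integrableOn
    (Filter.Eventually.of_forall fun z => (heatKernel_pos one_pos z).le)
    (ball_subset_ball ?_).eventuallyLE)
  rwa [le_div_iff₀ hr]

lemma volume_real_ball {r : ℝ} (hr : 0 < r) (x : EuclideanSpace ℝ (Fin n)) :
    volume.real (ball x r) = r ^ n * volume.real (ball (0 : EuclideanSpace ℝ (Fin n)) 1) := by
  rw [measureReal_def, Measure.addHaar_ball_of_pos _ _ hr, ENNReal.toReal_mul,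
    ENNReal.toReal_ofReal (by positivity), finrank_euclideanSpace, Fintype.card_fin, measureReal_def]

lemma volume_real_closedBall {r : ℝ} (hr : 0 ≤ r) (x : EuclideanSpace ℝ (Fin n)) :
    volume.real (closedBall x r)
      = r ^ n * volume.real (ball (0 : EuclideanSpace ℝ (Fin n)) 1) := by
  rw [measureReal_def, Measure.addHaar_closedBall _ _ hr, ENNReal.toReal_mul,
    ENNReal.toReal_ofReal (by positivity), finrank_euclideanSpace, Fintype.card_fin, measureReal_def]

lemma volume_real_ball_pos {r : ℝ} (hr : 0 < r) (x : EuclideanSpace ℝ (Fin n)) :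
    0 < volume.real (ball x r) :=
  ENNReal.toReal_pos (measure_ball_pos _ _ hr).ne' measure_ball_lt_top.ne

variable {ν : Measure (EuclideanSpace ℝ (Fin n))} {D : ℝ≥0}
  [IsLocallyFiniteMeasure ν] (h : DoublingBound ν D)
include h

lemma DoublingBound.integrableOn_heatAverage {r : ℝ} (hr : 0 < r)
    (x : EuclideanSpace ℝ (Fin n)) (R : ℝ) : IntegrableOn (heatAverage ν r) (ball x R) := by
  have : Continuous (heatAverage ν r) :=
    continuous_iff_continuousAt.2 fun x => (h.hasFDerivAt_heatAverage hr x).continuousAt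
  exact (this.continuousOn.integrableOn_compact (isCompact_closedBall x R)).mono_set
    ball_subset_closedBall

/-- Fubini: a kernel centred at a point of the ball leaves mass at least `θ` within distance `b`,
hence inside the enlarged ball. -/
lemma DoublingBound.mul_measure_ball_le_integral_heatAverage {r b θ : ℝ} (hr : 0 < r)
    (hθ : θ ≤ ∫ z : EuclideanSpace ℝ (Fin n) in ball 0 b, heatKernel r z)
    (x : EuclideanSpace ℝ (Fin n)) (R : ℝ) :
    θ * ν.real (ball x R) ≤ ∫ y in ball x (R + b), heatAverage ν r y := by
  have hc := continuous_heatKernel (n := n) r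
  have : IsFiniteMeasure (ν.restrict (ball x R)) := ⟨by
    rw [Measure.restrict_apply_univ]; exact measure_ball_lt_top' x R⟩
  have : IsFiniteMeasure ((volume : Measure (EuclideanSpace ℝ (Fin n))).restrict
    (ball x (R + b))) := ⟨by
    rw [Measure.restrict_apply_univ]; exact measure_ball_lt_top⟩
  have hbd : ∀ z : EuclideanSpace ℝ (Fin n), ‖heatKernel r z‖ ≤ kernelConst n * (r ^ n)⁻¹ := by
    intro z
    rw [Real.norm_of_nonneg (heatKernel_pos hr z).le]
    refine (heatKernel_le_sq_mul hr z).trans ((sq_mul_heatKernel_le hr z).trans ?_)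
    have := kernelConst_pos n
    have h2 : Real.exp (-(‖z‖ / r)) ≤ 1 := Real.exp_le_one_iff.2 (by
      have : 0 ≤ ‖z‖ / r := by positivity
      linarith)
    exact mul_le_of_le_one_right (by positivity) h2
  have hprod : Integrable (fun p : EuclideanSpace ℝ (Fin n) × EuclideanSpace ℝ (Fin n) =>
      heatKernel r (p.1 - p.2)) ((volume.restrict (ball x (R + b))).prod
        (ν.restrict (ball x R))) :=
    Integrable.of_bound (Continuous.aestronglyMeasurable (by fun_prop)) _
      (Filter.Eventually.of_forall fun p => hbd _)
  calc θ * ν.real (ball x R) = ∫ _ in ball x R, θ ∂ν := by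
        rw [setIntegral_const, smul_eq_mul, mul_comm]
    _ ≤ ∫ y in ball x R, (∫ y' in ball x (R + b), heatKernel r (y' - y)) ∂ν := by
        refine setIntegral_mono_on (integrableOn_const (measure_ball_lt_top' x R).ne)
          hprod.integral_prod_right measurableSet_ball fun y hy => hθ.trans ?_
        have hpre : (fun k => -y + k) ⁻¹' ball 0 b = ball y b := by
          ext k
          simp [mem_ball, dist_eq_norm, neg_add_eq_sub]
        have h1 := (measurePreserving_add_left volume (-y)).setIntegral_preimage_emb
            (measurableEmbedding_addLeft (-y)) (heatKernel r) (ball 0 b)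
        rw [hpre] at h1
        simp only [neg_add_eq_sub] at h1
        rw [← h1]
        refine setIntegral_mono_set
          ((integrable_heatKernel_volume hr).comp_sub_right y).integrableOn
          (Filter.Eventually.of_forall fun z => (heatKernel_pos hr _).le)
          (ball_subset_ball' ?_).eventuallyLE
        linarith [mem_ball.1 hy]
    _ = ∫ y' in ball x (R + b), ∫ y in ball x R, heatKernel r (y' - y) ∂ν :=
        (integral_integral_swap hprod).symm
    _ ≤ _ := by
        refine setIntegral_mono_on hprod.integral_prod_left
          (h.integrableOn_heatAverage hr x _) measurableSet_ball fun y _ => ?_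
        exact setIntegral_le_integral (h.integrable_heatKernel hr y)
          (Filter.Eventually.of_forall fun y => (heatKernel_pos hr _).le)

omit h in
lemma lintegral_measure_ball_le (x : EuclideanSpace ℝ (Fin n)) (R r : ℝ) :
    ∫⁻ y in ball x R, ν (ball y r)
      ≤ volume (ball (0 : EuclideanSpace ℝ (Fin n)) r) * ν (ball x (R + r)) := by
  have hm : MeasurableSet {p : EuclideanSpace ℝ (Fin n) × EuclideanSpace ℝ (Fin n) |
      dist p.1 p.2 < r} := measurableSet_lt (by fun_prop) (by fun_prop)
  calc _ ≤ ∫⁻ y in ball x R, (ν.restrict (ball x (R + r))) {z | dist y z < r} := by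
        refine setLIntegral_mono' measurableSet_ball fun y hy => ?_
        rw [Measure.restrict_apply (measurableSet_lt (by fun_prop) (by fun_prop))]
        refine measure_mono fun z hz => ⟨mem_ball'.1 hz, ?_⟩
        have := dist_triangle z y x
        rw [mem_ball] at hy hz ⊢
        linarith
    _ = ((volume.restrict (ball x R)).prod (ν.restrict (ball x (R + r)))) {p | dist p.1 p.2 < r} :=
        (Measure.prod_apply hm).symm
    _ = ∫⁻ z in ball x (R + r), volume.restrict (ball x R) {y | dist y z < r} ∂ν :=
        Measure.prod_apply_symm hm
    _ ≤ ∫⁻ z in ball x (R + r), volume (ball (0 : EuclideanSpace ℝ (Fin n)) r) ∂ν := by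
        refine lintegral_mono fun z => (Measure.restrict_apply_le _ _).trans ?_
        exact (Measure.addHaar_ball_center volume z r).le
    _ = _ := by rw [setLIntegral_const]

/-- Since `u_r(y) ≤ C r^{-n} ν(B(y,r))`, integrating in `y` by Tonelli returns a factor `r^n`. The
constant is therefore uniform in `r`. -/
lemma DoublingBound.integral_heatAverage_le {r : ℝ} (hr : 0 < r)
    (x : EuclideanSpace ℝ (Fin n)) (R : ℝ) :
    ∫ y in ball x R, heatAverage ν r y
      ≤ kernelConst n * expConst D * volume.real (ball (0 : EuclideanSpace ℝ (Fin n)) 1)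
        * ν.real (ball x (R + r)) := by
  have hfin : volume (ball (0 : EuclideanSpace ℝ (Fin n)) r) * ν (ball x (R + r)) < ⊤ :=
    ENNReal.mul_lt_top measure_ball_lt_top (measure_ball_lt_top' _ _)
  have hmeas : Measurable fun y => ν (ball y r) := by
    have hm : MeasurableSet {p : EuclideanSpace ℝ (Fin n) × EuclideanSpace ℝ (Fin n) |
      dist p.2 p.1 < r} := measurableSet_lt (by fun_prop) (by fun_prop)
    exact measurable_measure_prodMk_left hm
  have hint : IntegrableOn (fun y => ν.real (ball y r)) (ball x R) :=
    integrable_toReal_of_lintegral_ne_top hmeas.aemeasurable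
      ((lintegral_measure_ball_le x R r).trans_lt hfin).ne
  have hle : ∫ y in ball x R, ν.real (ball y r)
      ≤ volume.real (ball (0 : EuclideanSpace ℝ (Fin n)) r) * ν.real (ball x (R + r)) := by
    simp only [measureReal_def]
    rw [integral_toReal hmeas.aemeasurable
      (Filter.Eventually.of_forall fun y => measure_ball_lt_top' y r), ← ENNReal.toReal_mul]
    exact ENNReal.toReal_mono hfin.ne (lintegral_measure_ball_le x R r)
  calc _ ≤ ∫ y in ball x R, kernelConst n * expConst D * (r ^ n)⁻¹ * ν.real (ball y r) :=
        integral_mono (h.integrableOn_heatAverage hr x R) (hint.const_mul _)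
          fun y => h.heatAverage_le hr y
    _ ≤ kernelConst n * expConst D * (r ^ n)⁻¹
          * (volume.real (ball (0 : EuclideanSpace ℝ (Fin n)) r) * ν.real (ball x (R + r))) := by
        rw [integral_const_mul]
        have := kernelConst_pos n
        gcongr
    _ = _ := by
        rw [volume_real_ball hr]
        field_simp

end Mass

/-! ### Cutoff functions with a thin collar. -/

section Cutoff

lemma integral_le_of_tsupport_subset {n : ℕ} {ψ : EuclideanSpace ℝ (Fin n) → ℝ}
    (hψ : Continuous ψ) (hψ1 : ∀ y, ψ y ≤ 1) {x : EuclideanSpace ℝ (Fin n)} {t R : ℝ}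
    (hR : 0 < R) (ht : 0 ≤ t) (hsupp : tsupport ψ ⊆ closedBall x (t * R)) :
    ∫ y, ψ y ≤ t ^ n * volume.real (ball x R) := by
  have hψc : HasCompactSupport ψ := HasCompactSupport.of_support_subset_isCompact
    (isCompact_closedBall x _) ((subset_tsupport ψ).trans hsupp)
  calc ∫ y, ψ y ≤ ∫ y, (closedBall x (t * R)).indicator (fun _ => (1 : ℝ)) y := by
        refine integral_mono (hψ.integrable_of_hasCompactSupport hψc)
          ((integrable_indicator_iff measurableSet_closedBall).2
            (integrableOn_const (isCompact_closedBall x _).measure_lt_top.ne)) fun y => ?_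
        by_cases hy : y ∈ closedBall x (t * R)
        · rw [Set.indicator_of_mem hy]
          exact hψ1 y
        · rw [Set.indicator_of_notMem hy]
          exact (image_eq_zero_of_notMem_tsupport fun hy' => hy (hsupp hy')).le
    _ = t ^ n * volume.real (ball x R) := by
        rw [integral_indicator measurableSet_closedBall, setIntegral_const, smul_eq_mul, mul_one,
          volume_real_closedBall (by positivity), volume_real_ball hR]
        ring

/-- All cutoffs are rescalings of one bump, so `K` depends on `n` and `κ` alone. -/
lemma exists_cutoff (n : ℕ) {κ : ℝ} (hκ : 0 < κ) :
    ∃ K : ℝ, 0 ≤ K ∧ ∀ (x : EuclideanSpace ℝ (Fin n)) (R : ℝ), 0 < R →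
      ∃ ψ : EuclideanSpace ℝ (Fin n) → ℝ, ContDiff ℝ 1 ψ ∧ (∀ y, 0 ≤ ψ y) ∧ (∀ y, ψ y ≤ 1) ∧
        (∀ y ∈ ball x R, ψ y = 1) ∧ tsupport ψ ⊆ closedBall x ((1 + κ) * R) ∧
        (∀ y, ‖fderiv ℝ ψ y‖ ≤ K / R) ∧ ∫ y, ψ y ≤ (1 + κ) ^ n * volume.real (ball x R) := by
  let f : ContDiffBump (0 : EuclideanSpace ℝ (Fin n)) := ⟨1, 1 + κ, one_pos, by linarith⟩
  have hf : ContDiff ℝ 1 f := f.contDiff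
  obtain ⟨K, hK⟩ := (f.hasCompactSupport.fderiv (𝕜 := ℝ)).exists_bound_of_continuous
    (hf.continuous_fderiv one_ne_zero)
  refine ⟨K, (norm_nonneg _).trans (hK 0), fun x R hR => ?_⟩
  have hnorm : ∀ y : EuclideanSpace ℝ (Fin n), ‖R⁻¹ • (y - x)‖ = dist y x / R := fun y => by
    rw [norm_smul, norm_inv, Real.norm_of_nonneg hR.le, dist_eq_norm, div_eq_inv_mul]
  have hsupp : tsupport (fun y => f (R⁻¹ • (y - x))) ⊆ closedBall x ((1 + κ) * R) := by
    refine closure_minimal (fun y hy => ?_) isClosed_closedBall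
    have : R⁻¹ • (y - x) ∈ Function.support f := hy
    rw [f.support_eq, mem_ball_zero_iff, hnorm, div_lt_iff₀ hR] at this
    exact this.le
  refine ⟨fun y => f (R⁻¹ • (y - x)), hf.comp (by fun_prop), fun y => f.nonneg,
    fun y => f.le_one, fun y hy => ?_, hsupp, fun y => ?_,
    integral_le_of_tsupport_subset (hf.continuous.comp (by fun_prop)) (fun y => f.le_one) hR
      (by linarith) hsupp⟩
  · apply f.one_of_mem_closedBall
    rw [mem_closedBall_zero_iff, hnorm]
    exact (div_le_one hR).2 (mem_ball.1 hy).le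
  · have h1 : HasFDerivAt (fun y => R⁻¹ • (y - x))
        (R⁻¹ • ContinuousLinearMap.id ℝ (EuclideanSpace ℝ (Fin n))) y :=
      ((hasFDerivAt_id y).sub_const x).const_smul R⁻¹
    have h2 := ((hf.differentiable one_ne_zero (R⁻¹ • (y - x))).hasFDerivAt).comp y h1
    have h3 := h2.fderiv
    simp only [Function.comp_def] at h3
    rw [h3, ContinuousLinearMap.comp_smul, ContinuousLinearMap.comp_id, norm_smul, norm_inv,
      Real.norm_of_nonneg hR.le, div_eq_inv_mul]
    gcongr
    exact hK _

end Cutoff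

/-! ### From weights to measures, and Lebesgue differentiation with the Gaussian. -/

section Weight

variable {n : ℕ} {w : EuclideanSpace ℝ (Fin n) → ℝ} (hw : IsWeight w)
include hw

lemma IsWeight.isLocallyFiniteMeasure : IsLocallyFiniteMeasure (weightMeasure w) := by
  refine ⟨fun x => ?_⟩
  obtain ⟨s, hs, hi⟩ := hw.locallyIntegrable x
  obtain ⟨t, ht, hto, hxt⟩ := _root_.mem_nhds_iff.1 hs
  refine ⟨t, hto.mem_nhds hxt, ?_⟩
  unfold weightMeasure
  rw [withDensity_apply _ hto.measurableSet]
  refine lt_of_le_of_lt (lintegral_mono fun y => ?_) (hi.mono_set ht).2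
  exact Real.ofReal_le_enorm (w y)

lemma IsWeight.aemeasurable_ofReal : AEMeasurable (fun x => ENNReal.ofReal (w x)) :=
  hw.locallyIntegrable.aestronglyMeasurable.aemeasurable.ennreal_ofReal

lemma IsWeight.integral_weightMeasure (g : EuclideanSpace ℝ (Fin n) → ℝ) :
    ∫ y, g y ∂(weightMeasure w) = ∫ y, w y * g y := by
  unfold weightMeasure
  rw [integral_withDensity_eq_integral_toReal_smul₀ hw.aemeasurable_ofReal
    (Filter.Eventually.of_forall fun _ => ENNReal.ofReal_lt_top)]
  refine integral_congr_ae (hw.nonneg.mono fun y hy => ?_)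
  simp [ENNReal.toReal_ofReal hy]

lemma IsWeight.setIntegral_weightMeasure {s : Set (EuclideanSpace ℝ (Fin n))}
    (hs : MeasurableSet s) (g : EuclideanSpace ℝ (Fin n) → ℝ) :
    ∫ y in s, g y ∂(weightMeasure w) = ∫ y in s, w y * g y := by
  rw [← integral_indicator hs, hw.integral_weightMeasure, ← integral_indicator hs]
  congr 1
  ext y
  by_cases hy : y ∈ s <;> simp [hy]

lemma IsWeight.gaussianAverage_eq (r : ℝ) :
    gaussianAverage w r = heatAverage (weightMeasure w) r := by
  ext x
  unfold gaussianAverage heatAverage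
  rw [hw.integral_weightMeasure, convolution_def, dilation_gaussianKernel_eq_heatKernel]
  rfl

lemma IsWeight.measureReal_weightMeasure {s : Set (EuclideanSpace ℝ (Fin n))}
    (hs : MeasurableSet s) : (weightMeasure w).real s = ∫ y in s, w y := by
  have := hw.setIntegral_weightMeasure hs fun _ => 1
  simpa using this

lemma IsWeight.integrableOn_closedBall (x : EuclideanSpace ℝ (Fin n)) (r : ℝ) :
    IntegrableOn w (closedBall x r) :=
  hw.locallyIntegrable.integrableOn_isCompact (isCompact_closedBall x r)

/-- At a Lebesgue point, the part within `kρ` sees a kernel bounded by `C ρ^{-n}` and a vanishing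
mean oscillation, while the weight `(1+q)²` makes the rest `O(k^{-2})`. An upper bound suffices,
because it is used in `M - log u`, which decreases in `u`. -/
lemma IsWeight.ae_eventually_heatAverage_le {D : ℝ≥0} (h : DoublingBound (weightMeasure w) D) :
    ∀ᵐ x, 0 ≤ w x ∧ ∀ ε > 0, ∀ᶠ ρ in nhdsWithin (0 : ℝ) (Set.Ioi 0),
      heatAverage (weightMeasure w) ρ x ≤ w x + ε := by
  have := hw.isLocallyFiniteMeasure
  filter_upwards [hw.nonneg,
    IsUnifLocDoublingMeasure.ae_tendsto_average_norm_sub volume hw.locallyIntegrable 1]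
    with x hx0 hx
  refine ⟨hx0, fun ε hε => ?_⟩
  have havg : ∀ k : ℝ, 0 < k → Filter.Tendsto
      (fun ρ => ⨍ y in closedBall x (k * ρ), ‖w y - w x‖)
      (nhdsWithin (0 : ℝ) (Set.Ioi 0)) (nhds 0) := by
    intro k hk
    refine hx (fun _ => x) (fun ρ => k * ρ) ?_ ?_
    · refine tendsto_nhdsWithin_iff.2 ⟨?_, ?_⟩
      · have : Filter.Tendsto (fun ρ : ℝ => k * ρ) (nhds 0) (nhds (k * 0)) :=
          (continuous_const_mul k).tendsto 0
        rw [mul_zero] at this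
        exact this.mono_left nhdsWithin_le_nhds
      · filter_upwards [self_mem_nhdsWithin] with ρ hρ
        exact mul_pos hk hρ
    · filter_upwards [self_mem_nhdsWithin] with ρ hρ
      have : (0 : ℝ) < ρ := hρ
      exact mem_closedBall_self (by positivity)
  set ω := volume.real (ball (0 : EuclideanSpace ℝ (Fin n)) 1) with hω
  have hω0 : 0 < ω := volume_real_ball_pos one_pos _
  have hvol : ∀ r : ℝ, 0 < r → volume.real (closedBall x r) = r ^ n * ω := fun r hr =>
    volume_real_closedBall hr.le x
  have hI : ∀ r : ℝ, IntegrableOn (fun y => ‖w y - w x‖) (closedBall x r) := fun r =>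
    ((hw.integrableOn_closedBall x r).sub
      (integrableOn_const (isCompact_closedBall x r).measure_lt_top.ne)).norm
  have hint : ∀ r : ℝ, 0 < r → ∫ y in closedBall x r, ‖w y - w x‖
      = r ^ n * ω * ⨍ y in closedBall x r, ‖w y - w x‖ := fun r hr => by
    rw [setAverage_eq, hvol r hr, smul_eq_mul, ← mul_assoc, mul_inv_cancel₀ (by positivity),
      one_mul]
  set C := kernelConst n with hC
  have hC0 : 0 < C := kernelConst_pos n
  set C' := C * expConst D * (ω * (w x + 1)) with hC'
  have hC'0 : 0 ≤ C' := by positivity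
  -- The cut at `kρ` is fixed first, to make the tail small; how small `ρ` has to be then depends on
  -- `k`.
  obtain ⟨k, hk0, hk⟩ : ∃ k : ℝ, 0 < k ∧ C' / k ^ 2 ≤ ε / 2 := by
    have h1 : Filter.Tendsto (fun k : ℝ => C' / k ^ 2) Filter.atTop (nhds 0) :=
      tendsto_const_nhds.div_atTop (Filter.tendsto_pow_atTop two_ne_zero)
    obtain ⟨k, h2, h3⟩ := ((h1.eventually_le_const (half_pos hε)).and
      (Filter.eventually_gt_atTop 0)).exists
    exact ⟨k, h3, h2⟩
  have hnear : ∀ᶠ ρ in nhdsWithin (0 : ℝ) (Set.Ioi 0),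
      C * (k ^ n * ω) * ⨍ y in closedBall x (k * ρ), ‖w y - w x‖ ≤ ε / 2 := by
    have h1 := (havg k hk0).const_mul (C * (k ^ n * ω))
    rw [mul_zero] at h1
    exact h1.eventually_le_const (half_pos hε)
  have hone : ∀ᶠ ρ in nhdsWithin (0 : ℝ) (Set.Ioi 0),
      ⨍ y in closedBall x (1 * ρ), ‖w y - w x‖ ≤ 1 :=
    (havg 1 one_pos).eventually_le_const one_pos
  filter_upwards [hnear, hone, self_mem_nhdsWithin] with ρ h1 h2 hρ
  have hρ : 0 < ρ := hρ
  rw [one_mul] at h2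
  have hG := h.integrable_heatKernel hρ x
  have hS := h.integrable_sq_mul_heatKernel hρ x
  have hball : (weightMeasure w).real (ball x ρ) ≤ ρ ^ n * ω * (w x + 1) := by
    calc _ ≤ (weightMeasure w).real (closedBall x ρ) :=
          measureReal_mono ball_subset_closedBall (isCompact_closedBall x ρ).measure_lt_top.ne
      _ = ∫ y in closedBall x ρ, w y :=
          hw.measureReal_weightMeasure measurableSet_closedBall
      _ ≤ ∫ y in closedBall x ρ, (w x + ‖w y - w x‖) := by
          refine integral_mono (hw.integrableOn_closedBall x ρ)
            ((integrableOn_const (isCompact_closedBall x ρ).measure_lt_top.ne).add (hI ρ))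
            fun y => ?_
          have := Real.le_norm_self (w y - w x)
          simp only
          linarith
      _ = ρ ^ n * ω * w x + ρ ^ n * ω * ⨍ y in closedBall x ρ, ‖w y - w x‖ := by
          have i1 : IntegrableOn (fun _ => w x) (closedBall x ρ) volume :=
            integrableOn_const (isCompact_closedBall x ρ).measure_lt_top.ne
          rw [integral_add i1 (hI ρ), setIntegral_const, hvol ρ hρ, hint ρ hρ, smul_eq_mul]
      _ ≤ ρ ^ n * ω * w x + ρ ^ n * ω * 1 := by gcongr
      _ = _ := by ring
  have hfar : ∫ y in (closedBall x (k * ρ))ᶜ, heatKernel ρ (x - y) ∂(weightMeasure w)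
      ≤ ε / 2 := by
    calc _ ≤ ∫ y in (closedBall x (k * ρ))ᶜ,
            (k ^ 2)⁻¹ * ((1 + ‖x - y‖ / ρ) ^ 2 * heatKernel ρ (x - y)) ∂(weightMeasure w) := by
          refine setIntegral_mono_on hG.integrableOn (hS.const_mul _).integrableOn
            measurableSet_closedBall.compl fun y hy => ?_
          rw [← mul_assoc]
          refine le_mul_of_one_le_left (heatKernel_pos hρ _).le ?_
          rw [inv_mul_eq_div, one_le_div (by positivity)]
          have : k < ‖x - y‖ / ρ := by
            rw [lt_div_iff₀ hρ, ← dist_eq_norm, dist_comm]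
            simpa using hy
          gcongr
          linarith
      _ ≤ ∫ y, (k ^ 2)⁻¹ * ((1 + ‖x - y‖ / ρ) ^ 2 * heatKernel ρ (x - y)) ∂(weightMeasure w) :=
          setIntegral_le_integral (hS.const_mul _) (Filter.Eventually.of_forall fun y => by
            have := heatKernel_pos hρ (x - y)
            exact mul_nonneg (by positivity) (by positivity))
      _ = (k ^ 2)⁻¹ * ∫ y, (1 + ‖x - y‖ / ρ) ^ 2 * heatKernel ρ (x - y) ∂(weightMeasure w) :=
          integral_const_mul _ _
      _ ≤ (k ^ 2)⁻¹ * (C * expConst D * (ρ ^ n)⁻¹ * (ρ ^ n * ω * (w x + 1))) := by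
          gcongr
          refine (h.integral_sq_mul_heatKernel_le hρ x).trans ?_
          gcongr
      _ = C' / k ^ 2 := by
          rw [hC']
          field_simp
      _ ≤ ε / 2 := hk
  have hbd : ∀ z : EuclideanSpace ℝ (Fin n), heatKernel ρ z ≤ C * (ρ ^ n)⁻¹ := by
    intro z
    refine (heatKernel_le_sq_mul hρ z).trans ((sq_mul_heatKernel_le hρ z).trans ?_)
    have h2 : Real.exp (-(‖z‖ / ρ)) ≤ 1 := Real.exp_le_one_iff.2 (by
      have : 0 ≤ ‖z‖ / ρ := by positivity
      linarith)
    exact mul_le_of_le_one_right (by positivity) h2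
  have hGv : Integrable (fun y => heatKernel ρ (x - y)) :=
    (integrable_heatKernel_volume hρ).comp_sub_left x
  have hnear' : ∫ y in closedBall x (k * ρ), heatKernel ρ (x - y) ∂(weightMeasure w)
      ≤ w x + ε / 2 := by
    rw [hw.setIntegral_weightMeasure measurableSet_closedBall]
    have i1 : IntegrableOn (fun y => w x * heatKernel ρ (x - y)) (closedBall x (k * ρ)) :=
      (hGv.const_mul _).integrableOn
    have i2 := (hI (k * ρ)).const_mul (C * (ρ ^ n)⁻¹)
    calc _ ≤ ∫ y in closedBall x (k * ρ),
            (w x * heatKernel ρ (x - y) + C * (ρ ^ n)⁻¹ * ‖w y - w x‖) := by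
          refine integral_mono_of_nonneg ?_ (i1.add i2) (Filter.Eventually.of_forall fun y => ?_)
          · exact (ae_restrict_of_ae hw.nonneg).mono fun y hy =>
              mul_nonneg hy (heatKernel_pos hρ _).le
          · have a1 := Real.le_norm_self (w y - w x)
            have a3 : heatKernel ρ (x - y) * (w y - w x)
                ≤ heatKernel ρ (x - y) * ‖w y - w x‖ :=
              mul_le_mul_of_nonneg_left a1 (heatKernel_pos hρ _).le
            have a4 := mul_le_mul_of_nonneg_right (hbd (x - y)) (norm_nonneg (w y - w x))
            simp only
            linarith
      _ = w x * (∫ y in closedBall x (k * ρ), heatKernel ρ (x - y))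
            + C * (ρ ^ n)⁻¹ * ((k * ρ) ^ n * ω * ⨍ y in closedBall x (k * ρ), ‖w y - w x‖) := by
          rw [integral_add i1 i2, integral_const_mul, integral_const_mul,
            hint (k * ρ) (by positivity)]
      _ ≤ w x * 1 + ε / 2 := by
          gcongr
          · refine (setIntegral_le_integral hGv
              (Filter.Eventually.of_forall fun y => (heatKernel_pos hρ _).le)).trans ?_
            rw [integral_sub_left_eq_self (fun y => heatKernel ρ y) volume x,
              integral_heatKernel hρ]
          · refine le_trans (le_of_eq ?_) h1
            rw [mul_pow]
            field_simp
      _ = _ := by rw [mul_one]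
  have hsplit : heatAverage (weightMeasure w) ρ x
      = ∫ y in closedBall x (k * ρ), heatKernel ρ (x - y) ∂(weightMeasure w)
        + ∫ y in (closedBall x (k * ρ))ᶜ, heatKernel ρ (x - y) ∂(weightMeasure w) :=
    (integral_add_compl measurableSet_closedBall hG).symm
  linarith

end Weight

/-! ### Passage to the limit of vanishing scale, and the Carleson norm as iterated integrals. -/

section Fatou

variable {n : ℕ} {w : EuclideanSpace ℝ (Fin n) → ℝ} (hw : IsWeight w)
include hw

/-- Fatou's lemma applies to the non-negative deficits `(M - log u_ρ)₊` and gives both positivity of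
`w` and integrability of `(M - log w)₊`. The opposite part satisfies `(log w - M)₊ ≤ e^{-M} w`. -/
lemma IsWeight.integrableOn_log_of_forall_integral_le {D : ℝ≥0}
    (h : DoublingBound (weightMeasure w) D) (hν : weightMeasure w ≠ 0)
    {x : EuclideanSpace ℝ (Fin n)} {R M K ρ₀ : ℝ} (hρ₀ : 0 < ρ₀)
    (hK : ∀ ρ, 0 < ρ → ρ < ρ₀ →
      ∫ y in ball x R, max (M - Real.log (heatAverage (weightMeasure w) ρ y)) 0 ≤ K) :
    (∀ᵐ z ∂(volume.restrict (ball x R)), 0 < w z) ∧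
      IntegrableOn (fun z => Real.log (w z)) (ball x R) ∧
      M * volume.real (ball x R) - K ≤ ∫ z in ball x R, Real.log (w z) := by
  have := hw.isLocallyFiniteMeasure
  set ν := weightMeasure w with hνdef
  set ρ : ℕ → ℝ := fun k => ρ₀ / (k + 2) with hρdef
  have hρpos : ∀ k, 0 < ρ k := fun k => by positivity
  have hρlt : ∀ k, ρ k < ρ₀ := fun k => by
    rw [hρdef]
    refine div_lt_self hρ₀ ?_
    have : (0 : ℝ) ≤ k := by positivity
    linarith
  have hρlim : Filter.Tendsto ρ Filter.atTop (nhdsWithin (0 : ℝ) (Set.Ioi 0)) := by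
    refine tendsto_nhdsWithin_iff.2 ⟨?_, Filter.Eventually.of_forall hρpos⟩
    refine Filter.Tendsto.div_atTop tendsto_const_nhds ?_
    exact Filter.tendsto_atTop_add_const_right _ _ tendsto_natCast_atTop_atTop
  set f : ℕ → EuclideanSpace ℝ (Fin n) → ℝ≥0∞ := fun k y =>
    ENNReal.ofReal (M - Real.log (heatAverage ν (ρ k) y)) with hf
  have hfm : ∀ k, Measurable (f k) := fun k =>
    (measurable_const.sub (((measurable_heatAverage ν).comp
      (measurable_id.prodMk measurable_const)).log)).ennreal_ofReal
  set g : EuclideanSpace ℝ (Fin n) → ℝ≥0∞ := fun y => Filter.liminf (fun k => f k y) Filter.atTop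
    with hg
  have hgm : Measurable g := Measurable.liminf hfm
  have hfle : ∀ k, ∫⁻ y in ball x R, f k y ≤ ENNReal.ofReal K := by
    intro k
    refine le_trans (le_of_eq ?_) (ENNReal.ofReal_le_ofReal (hK (ρ k) (hρpos k) (hρlt k)))
    have hc : Continuous fun y => max (M - Real.log (heatAverage ν (ρ k) y)) 0 :=
      (continuous_const.sub (h.continuous_log_heatAverage hν (hρpos k))).max continuous_const
    rw [ofReal_integral_eq_lintegral_ofReal
      ((hc.continuousOn.integrableOn_compact (isCompact_closedBall x R)).mono_set
        ball_subset_closedBall)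
      (Filter.Eventually.of_forall fun y => le_max_right _ _)]
    refine lintegral_congr fun y => ?_
    rw [hf]
    simp
  have hgle : ∫⁻ y in ball x R, g y ≤ ENNReal.ofReal K := by
    refine (lintegral_liminf_le hfm).trans ?_
    exact Filter.liminf_le_of_frequently_le (Filter.Frequently.of_forall hfle)
  have hgtop : ∀ᵐ y ∂(volume.restrict (ball x R)), g y < ⊤ :=
    ae_lt_top hgm (hgle.trans_lt ENNReal.ofReal_lt_top).ne
  have hlower : ∀ᵐ y, 0 ≤ w y ∧ ∀ ε > 0, ENNReal.ofReal (M - Real.log (w y + ε)) ≤ g y := by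
    filter_upwards [hw.ae_eventually_heatAverage_le h] with y hy
    refine ⟨hy.1, fun ε hε => ?_⟩
    refine Filter.le_liminf_of_le (by isBoundedDefault) ?_
    filter_upwards [hρlim.eventually (hy.2 ε hε)] with k hk
    refine ENNReal.ofReal_le_ofReal (sub_le_sub_left ?_ _)
    exact Real.log_le_log (h.heatAverage_pos hν (hρpos k) y) hk
  have hpos : ∀ᵐ z ∂(volume.restrict (ball x R)), 0 < w z := by
    filter_upwards [hgtop, ae_restrict_of_ae hlower] with y h1 h2
    refine lt_of_le_of_ne h2.1 fun h0 => ?_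
    -- Where `w y = 0`, this choice of `ε` makes `M - log ε` equal to `g y + 1`, which exceeds the
    -- upper bound `g y`.
    have h3 : Real.exp (M - ((g y).toReal + 1)) > 0 := Real.exp_pos _
    have h4 := h2.2 _ h3
    rw [← h0, zero_add, Real.log_exp, sub_sub_cancel, ENNReal.ofReal_le_iff_le_toReal h1.ne] at h4
    linarith
  have hle : ∀ᵐ z ∂(volume.restrict (ball x R)), ENNReal.ofReal (M - Real.log (w z)) ≤ g z := by
    filter_upwards [hpos, ae_restrict_of_ae hlower] with y h1 h2
    have h3 : Filter.Tendsto (fun ε => ENNReal.ofReal (M - Real.log (w y + ε)))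
        (nhdsWithin (0 : ℝ) (Set.Ioi 0)) (nhds (ENNReal.ofReal (M - Real.log (w y)))) := by
      refine ENNReal.tendsto_ofReal (tendsto_const_nhds.sub ?_)
      have h4 : ContinuousAt (fun ε => Real.log (w y + ε)) 0 :=
        (continuousAt_const.add continuousAt_id).log (by simpa using h1.ne')
      have h5 := h4.tendsto
      rw [add_zero] at h5
      exact h5.mono_left nhdsWithin_le_nhds
    refine le_of_tendsto h3 ?_
    filter_upwards [self_mem_nhdsWithin] with ε hε
    exact h2.2 ε hε
  have hwi : IntegrableOn w (ball x R) :=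
    (hw.integrableOn_closedBall x R).mono_set ball_subset_closedBall
  have hlm : AEStronglyMeasurable (fun z => Real.log (w z)) (volume.restrict (ball x R)) :=
    hwi.1.aemeasurable.log.aestronglyMeasurable
  have hneg_le : ∫⁻ z in ball x R, ENNReal.ofReal (max (M - Real.log (w z)) 0)
      ≤ ENNReal.ofReal K := by
    refine le_trans (lintegral_mono_ae ?_) hgle
    filter_upwards [hle] with z hz
    simpa using hz
  have hnegm : AEStronglyMeasurable (fun z => max (M - Real.log (w z)) 0)
      (volume.restrict (ball x R)) :=
    ((aemeasurable_const.sub hlm.aemeasurable).max aemeasurable_const).aestronglyMeasurable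
  have hnn : 0 ≤ᵐ[volume.restrict (ball x R)] fun z => max (M - Real.log (w z)) 0 :=
    Filter.Eventually.of_forall fun z => le_max_right _ _
  have hneg : IntegrableOn (fun z => max (M - Real.log (w z)) 0) (ball x R) := by
    refine ⟨hnegm, ?_⟩
    rw [hasFiniteIntegral_iff_ofReal hnn]
    exact hneg_le.trans_lt ENNReal.ofReal_lt_top
  have hK0 : 0 ≤ K := (setIntegral_nonneg measurableSet_ball fun y _ => le_max_right _ _).trans
    (hK (ρ 0) (hρpos 0) (hρlt 0))
  have hneg_int : ∫ z in ball x R, max (M - Real.log (w z)) 0 ≤ K := by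
    rw [integral_eq_lintegral_of_nonneg_ae hnn hnegm]
    exact ENNReal.toReal_le_of_le_ofReal hK0 hneg_le
  have hposi : IntegrableOn (fun z => max (Real.log (w z) - M) 0) (ball x R) := by
    refine (hwi.const_mul (Real.exp (-M))).mono'
      ((hlm.aemeasurable.sub aemeasurable_const).max aemeasurable_const).aestronglyMeasurable ?_
    filter_upwards [hpos] with z hz
    rw [Real.norm_of_nonneg (le_max_right _ _)]
    refine max_le ?_ (by positivity)
    have := Real.add_one_le_exp (Real.log (w z) - M)
    rw [sub_eq_add_neg, Real.exp_add, Real.exp_log hz] at this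
    linarith
  have hdec : (fun z => Real.log (w z)) = fun z =>
      (M + max (Real.log (w z) - M) 0) - max (M - Real.log (w z)) 0 := by
    ext z
    rcases le_total (Real.log (w z)) M with h1 | h1
    · rw [max_eq_right (by linarith), max_eq_left (by linarith)]
      ring
    · rw [max_eq_left (by linarith), max_eq_right (by linarith)]
      ring
  have hMi : IntegrableOn (fun _ => M) (ball x R) volume :=
    integrableOn_const measure_ball_lt_top.ne
  have hMi' : IntegrableOn (fun z => M + max (Real.log (w z) - M) 0) (ball x R) := hMi.add hposi
  refine ⟨hpos, ?_, ?_⟩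
  · rw [hdec]
    exact hMi'.sub hneg
  · rw [hdec, integral_sub hMi' hneg, integral_add hMi hposi, setIntegral_const, smul_eq_mul]
    have : 0 ≤ ∫ z in ball x R, max (Real.log (w z) - M) 0 :=
      setIntegral_nonneg measurableSet_ball fun y _ => le_max_right _ _
    linarith

/-- Finiteness of the Carleson norm gives integrability on the product, so that Fubini's theorem
applies to real-valued integrals. -/
lemma IsWeight.carlesonBound {D : ℝ≥0} (h : DoublingBound (weightMeasure w) D)
    (hν : weightMeasure w ≠ 0) {δ : ℝ} (hδ : 0 ≤ δ)
    (hC : carlesonNorm (carlesonMeasure w) ≤ ENNReal.ofReal δ) :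
    CarlesonBound (weightMeasure w) δ := by
  have := hw.isLocallyFiniteMeasure
  intro x R hR
  set ν := weightMeasure w with hνdef
  set F : EuclideanSpace ℝ (Fin n) × ℝ → ℝ := fun p => ‖logGradient ν p.2 p.1‖ ^ 2 * p.2 with hF
  have hFm : Measurable F := by
    have := measurable_logGradient ν
    fun_prop
  have hV0 : volume (ball x R) ≠ 0 := (measure_ball_pos volume x hR).ne'
  have hVt : volume (ball x R) ≠ ⊤ := measure_ball_lt_top.ne
  have h1 : carlesonMeasure w (ball x R ×ˢ Set.Ioo 0 R)
      ≤ ENNReal.ofReal δ * volume (ball x R) := by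
    have h2 : (volume (ball x R))⁻¹ * carlesonMeasure w (ball x R ×ˢ Set.Ioo 0 R)
        ≤ ENNReal.ofReal δ := by
      unfold carlesonNorm at hC
      simp only [iSup_le_iff] at hC
      exact hC x R hR
    calc _ = volume (ball x R) * ((volume (ball x R))⁻¹
            * carlesonMeasure w (ball x R ×ˢ Set.Ioo 0 R)) := by
          rw [← mul_assoc, ENNReal.mul_inv_cancel hV0 hVt, one_mul]
      _ ≤ volume (ball x R) * ENNReal.ofReal δ := by gcongr
      _ = _ := mul_comm _ _
  have hS : MeasurableSet (ball x R ×ˢ Set.Ioo (0 : ℝ) R) :=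
    measurableSet_ball.prod measurableSet_Ioo
  have hprod : (volume : Measure (EuclideanSpace ℝ (Fin n) × ℝ)).restrict
      (ball x R ×ˢ Set.Ioo 0 R)
      = (volume.restrict (ball x R)).prod (volume.restrict (Set.Ioo 0 R)) := by
    rw [Measure.volume_eq_prod, Measure.prod_restrict]
  have h3 : ∫⁻ p, ENNReal.ofReal (F p)
      ∂((volume.restrict (ball x R)).prod (volume.restrict (Set.Ioo 0 R)))
      ≤ ENNReal.ofReal δ * volume (ball x R) := by
    refine le_trans (le_of_eq ?_) h1
    unfold carlesonMeasure
    rw [withDensity_apply _ hS, Measure.restrict_restrict hS, ← hprod]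
    have : ball x R ×ˢ Set.Ioo (0 : ℝ) R ∩ Set.univ ×ˢ Set.Ioi 0
        = ball x R ×ˢ Set.Ioo (0 : ℝ) R :=
      Set.inter_eq_left.2 (Set.prod_mono (Set.subset_univ _) fun s hs => hs.1)
    rw [this]
    refine setLIntegral_congr_fun hS fun p hp => ?_
    simp only [hF]
    rw [hw.gaussianAverage_eq, h.gradient_log_heatAverage hν hp.2.1]
  have hae : ∀ᵐ p ∂((volume.restrict (ball x R)).prod (volume.restrict (Set.Ioo 0 R))),
      0 ≤ F p := by
    rw [← hprod]
    refine (ae_restrict_iff' hS).2 (Filter.Eventually.of_forall fun p hp => ?_)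
    exact mul_nonneg (by positivity) hp.2.1.le
  have hfin : ENNReal.ofReal δ * volume (ball x R) ≠ ⊤ :=
    ENNReal.mul_ne_top ENNReal.ofReal_ne_top hVt
  have hFi : Integrable F ((volume.restrict (ball x R)).prod (volume.restrict (Set.Ioo 0 R))) := by
    refine ⟨hFm.aestronglyMeasurable, ?_⟩
    rw [hasFiniteIntegral_iff_ofReal hae]
    exact h3.trans_lt hfin.lt_top
  refine ⟨hFi.integral_prod_right, ?_⟩
  have h4 : ∫ s in Set.Ioo 0 R, (∫ y in ball x R, ‖logGradient ν s y‖ ^ 2 * s)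
      = ∫ p, F p ∂((volume.restrict (ball x R)).prod (volume.restrict (Set.Ioo 0 R))) :=
    (integral_prod_symm F hFi).symm
  rw [h4, integral_eq_lintegral_of_nonneg_ae hae hFm.aestronglyMeasurable]
  have h5 := ENNReal.toReal_mono hfin h3
  rwa [ENNReal.toReal_mul, ENNReal.toReal_ofReal hδ] at h5

end Fatou

/-! ### Small oscillation at a good scale, and the truncated logarithm. -/

section Oscillation

variable {n : ℕ}

lemma exists_carleson_oscillation (n : ℕ) (D : ℝ≥0) {η τ : ℝ} (hη : 0 < η) (hτ : 0 < τ)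
    (hτ1 : τ ≤ 1) :
    ∃ δ₁ : ℝ, 0 < δ₁ ∧ ∀ (ν : Measure (EuclideanSpace ℝ (Fin n))) [IsLocallyFiniteMeasure ν],
      DoublingBound ν D → ν ≠ 0 → ∀ δ, 0 ≤ δ → δ ≤ δ₁ → CarlesonBound ν δ →
      ∀ (x : EuclideanSpace ℝ (Fin n)) (R : ℝ), 0 < R →
        ∃ σ ∈ Set.Ioo (τ * R / 2) (τ * R), ∀ y ∈ ball x (2 * R),
          |Real.log (heatAverage ν σ y) - Real.log (heatAverage ν σ x)| ≤ η := by
  have hA := harnackConst_nonneg D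
  set A := harnackConst D with hAdef
  -- With averaging radius `βσ`, the Harnack error `2Aβ` is at most `η/2`.
  set β := min 1 (η / (4 * (A + 1))) with hβ
  have hβ0 : 0 < β := lt_min one_pos (by positivity)
  have hβ1 : β ≤ 1 := min_le_left _ _
  have hβη : 2 * (A * β) ≤ η / 2 := by
    have h1 : β ≤ η / (4 * (A + 1)) := min_le_right _ _
    rw [le_div_iff₀ (by positivity)] at h1
    nlinarith
  -- `N` bounds the volume ratio of balls of radii `3R` and `βσ`, since `σ > τR/2`.
  set N := (6 / (β * τ)) ^ n with hN
  have hN0 : 0 < N := by positivity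
  -- This makes the `L¹`-to-`L²` loss `4aN` equal to `η/4`; the choice of `δ₁` below bounds the
  -- remaining term by `η/4`.
  set a := η / (16 * N) with ha
  have ha0 : 0 < a := by positivity
  refine ⟨η * a * τ ^ 2 / (64 * N), by positivity, ?_⟩
  intro ν _ h hν δ hδ0 hδ hC x R hR
  obtain ⟨σ, hσ, hG⟩ := hC.exists_scale x (R := 3 * R) (T := τ * R) (by positivity)
    (by nlinarith)
  refine ⟨σ, hσ, fun y hy => ?_⟩
  have hσ0 : 0 < σ := lt_trans (by positivity) hσ.1
  have hσR : σ ≤ R := hσ.2.le.trans (by nlinarith)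
  have key := h.abs_log_sub_le_of_integral_le hν hσ0 (b := β * σ) (a := a / R) (by positivity)
    (by nlinarith) (by positivity) hG hy (mem_ball_self (by positivity))
  refine key.trans ?_
  have h1 : 2 * (A / σ * (β * σ)) = 2 * (A * β) := by field_simp
  rw [h1]
  have hV3 : volume.real (ball x (3 * R))
      / volume.real (ball (0 : EuclideanSpace ℝ (Fin n)) (β * σ)) ≤ N := by
    have hω := volume_real_ball_pos one_pos (0 : EuclideanSpace ℝ (Fin n))
    rw [volume_real_ball (by positivity : 0 < 3 * R), volume_real_ball (mul_pos hβ0 hσ0),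
      mul_div_mul_right _ _ hω.ne', ← div_pow, hN]
    refine pow_le_pow_left₀ (by positivity) ?_ n
    rw [div_le_div_iff₀ (by positivity) (by positivity)]
    nlinarith [mul_lt_mul_of_pos_left hσ.1 hβ0]
  have h2 : (a / R * volume.real (ball x (3 * R)) + 4 * δ / (τ * R) ^ 2
        * volume.real (ball x (3 * R)) / (a / R)) * (4 * R)
        / volume.real (ball (0 : EuclideanSpace ℝ (Fin n)) (β * σ))
      = (4 * a + 16 * δ / (a * τ ^ 2)) * (volume.real (ball x (3 * R))
        / volume.real (ball (0 : EuclideanSpace ℝ (Fin n)) (β * σ))) := by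
    field_simp
    ring
  rw [h2]
  have h3 : 16 * δ / (a * τ ^ 2) ≤ η / (4 * N) := by
    rw [le_div_iff₀ (by positivity)] at hδ
    rw [div_le_div_iff₀ (by positivity) (by positivity)]
    nlinarith
  calc _ ≤ η / 2 + (4 * a + 16 * δ / (a * τ ^ 2)) * N := by gcongr
    _ ≤ η / 2 + (4 * a + η / (4 * N)) * N := by gcongr
    _ = η := by
      rw [ha]
      field_simp
      ring

variable {ν : Measure (EuclideanSpace ℝ (Fin n))} {D : ℝ≥0}
  [IsLocallyFiniteMeasure ν] (h : DoublingBound ν D) (hν : ν ≠ 0)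
include h hν

/-- Pointwise, `1_B (M - log u)₊ ≤ ψ (M - log u) + e^{-M} u` on `2B`: the last term pays wherever
`log u > M`, because `t ≤ e^t` with `t = log u - M`. The integral of `ψ log u` is then carried from
scale `ρ` to `σ`, where `log u ≥ c`. -/
lemma DoublingBound.integral_max_sub_log_le {δ : ℝ} (hC : CarlesonBound ν δ)
    {ψ : EuclideanSpace ℝ (Fin n) → ℝ} (hψ : ContDiff ℝ 1 ψ) (hψ0 : ∀ x, 0 ≤ ψ x)
    (hψ1 : ∀ x, ψ x ≤ 1) {x : EuclideanSpace ℝ (Fin n)} {R : ℝ}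
    (hψR : ∀ y ∈ ball x R, ψ y = 1) {K : ℝ} (hsupp : tsupport ψ ⊆ ball x (2 * R))
    (hK : ∀ y, ‖fderiv ℝ ψ y‖ ≤ K) {ρ σ c : ℝ} (hρ : 0 < ρ) (hρσ : ρ ≤ σ) (hσ : σ < R)
    (hc : ∀ y ∈ ball x (2 * R), c ≤ Real.log (heatAverage ν σ y)) (M : ℝ) :
    ∫ y in ball x R, max (M - Real.log (heatAverage ν ρ y)) 0
      ≤ (M - c) * (∫ y, ψ y) + (δ + (σ * K) ^ 2) * volume.real (ball x (2 * R))
        + Real.exp (-M) * ∫ y in ball x (2 * R), heatAverage ν ρ y := by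
  have hσ0 : 0 < σ := hρ.trans_le hρσ
  have hR : 0 < R := hσ0.trans hσ
  have hψc : HasCompactSupport ψ := HasCompactSupport.of_support_subset_isCompact
    (isCompact_closedBall x (2 * R))
    ((subset_tsupport ψ).trans (hsupp.trans ball_subset_closedBall))
  have hzero : ∀ y, y ∉ ball x (2 * R) → ψ y = 0 := fun y hy =>
    image_eq_zero_of_notMem_tsupport fun hy' => hy (hsupp hy')
  have hLc := fun {s : ℝ} (hs : 0 < s) => h.continuous_log_heatAverage hν hs
  have iψ : Integrable ψ := hψ.continuous.integrable_of_hasCompactSupport hψc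
  have iL : ∀ {s : ℝ}, 0 < s → Integrable fun y => ψ y * Real.log (heatAverage ν s y) := fun hs =>
    (hψ.continuous.mul (hLc hs)).integrable_of_hasCompactSupport hψc.mul_right
  have iu := h.integrableOn_heatAverage hρ x (2 * R)
  have i1 : Integrable fun y => M * ψ y - ψ y * Real.log (heatAverage ν ρ y) :=
    (iψ.const_mul M).sub (iL hρ)
  have i2 : Integrable ((ball x (2 * R)).indicator fun y => Real.exp (-M) * heatAverage ν ρ y) :=
    IntegrableOn.integrable_indicator (iu.const_mul _) measurableSet_ball
  have hmax : Continuous fun y => max (M - Real.log (heatAverage ν ρ y)) 0 :=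
    (continuous_const.sub (hLc hρ)).max continuous_const
  have i3 : IntegrableOn (fun y => max (M - Real.log (heatAverage ν ρ y)) 0) (ball x R) :=
    (hmax.continuousOn.integrableOn_compact (isCompact_closedBall x R)).mono_set
      ball_subset_closedBall
  have hpt : ∀ y, (ball x R).indicator (fun y => max (M - Real.log (heatAverage ν ρ y)) 0) y
      ≤ (M * ψ y - ψ y * Real.log (heatAverage ν ρ y))
        + (ball x (2 * R)).indicator (fun y => Real.exp (-M) * heatAverage ν ρ y) y := by
    intro y
    have hu := h.heatAverage_pos hν hρ y
    have hexp := Real.add_one_le_exp (-M + Real.log (heatAverage ν ρ y))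
    rw [Real.exp_add, Real.exp_log hu] at hexp
    have hpos : 0 ≤ Real.exp (-M) * heatAverage ν ρ y := by positivity
    by_cases hy2 : y ∈ ball x (2 * R)
    · rw [Set.indicator_of_mem hy2]
      by_cases hy : y ∈ ball x R
      · rw [Set.indicator_of_mem hy, hψR y hy]
        exact max_le (by linarith) (by linarith)
      · rw [Set.indicator_of_notMem hy]
        have h0 := hψ0 y
        have h1 := hψ1 y
        rcases le_total (Real.log (heatAverage ν ρ y)) M with h2 | h2
        · nlinarith
        · nlinarith
    · have hy : y ∉ ball x R := fun hy => hy2 (ball_subset_ball (by linarith) hy)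
      rw [Set.indicator_of_notMem hy, Set.indicator_of_notMem hy2, hzero y hy2]
      simp
  have hstep := h.integral_mul_log_sub_le hν hC hψ hψ1 hsupp hK hρ hρσ (by linarith)
  have hσc : c * (∫ y, ψ y) ≤ ∫ y, ψ y * Real.log (heatAverage ν σ y) := by
    rw [← integral_const_mul]
    refine integral_mono (iψ.const_mul c) (iL hσ0) fun y => ?_
    by_cases hy : y ∈ ball x (2 * R)
    · simp only
      rw [mul_comm c]
      exact mul_le_mul_of_nonneg_left (hc y hy) (hψ0 y)
    · simp [hzero y hy]
  calc _ = ∫ y, (ball x R).indicator (fun y => max (M - Real.log (heatAverage ν ρ y)) 0) y :=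
        (integral_indicator measurableSet_ball).symm
    _ ≤ ∫ y, ((M * ψ y - ψ y * Real.log (heatAverage ν ρ y))
        + (ball x (2 * R)).indicator (fun y => Real.exp (-M) * heatAverage ν ρ y) y) :=
        integral_mono (i3.integrable_indicator measurableSet_ball) (i1.add i2) hpt
    _ = M * (∫ y, ψ y) - (∫ y, ψ y * Real.log (heatAverage ν ρ y))
          + Real.exp (-M) * ∫ y in ball x (2 * R), heatAverage ν ρ y := by
        rw [integral_add i1 i2, integral_sub (iψ.const_mul M) (iL hρ), integral_const_mul,
          integral_indicator measurableSet_ball, integral_const_mul]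
    _ ≤ _ := by linarith

end Oscillation

/-! ### Choice of the parameters and conclusion. -/

section Main

lemma exists_one_add_pow_le (n : ℕ) {t : ℝ} (ht : 1 < t) :
    ∃ κ : ℝ, 0 < κ ∧ κ < 1 ∧ (1 + κ) ^ n ≤ t := by
  have h1 : Filter.Tendsto (fun κ : ℝ => (1 + κ) ^ n) (nhdsWithin 0 (Set.Ioi 0)) (nhds 1) := by
    have : Continuous fun κ : ℝ => (1 + κ) ^ n := by fun_prop
    have h2 := this.tendsto 0
    simp only [add_zero, one_pow] at h2
    exact h2.mono_left nhdsWithin_le_nhds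
  obtain ⟨κ, h2, h3⟩ := ((h1.eventually_le_const ht).and (Ioo_mem_nhdsGT one_pos)).exists
  exact ⟨κ, h3.1, h3.2, h2⟩

variable {n : ℕ} {ν : Measure (EuclideanSpace ℝ (Fin n))} {D : ℝ≥0}
  [IsLocallyFiniteMeasure ν] (h : DoublingBound ν D) (hν : ν ≠ 0)

lemma volume_real_ball_mul {t R : ℝ} (ht : 0 < t) (hR : 0 < R) (x : EuclideanSpace ℝ (Fin n)) :
    volume.real (ball x (t * R)) = t ^ n * volume.real (ball x R) := by
  rw [volume_real_ball (mul_pos ht hR), volume_real_ball hR, mul_pow, mul_assoc]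

include h

lemma DoublingBound.measureReal_ball_le (x : EuclideanSpace ℝ (Fin n)) {R ρ : ℝ} (hR : 0 < R)
    (hρ : ρ ≤ R) : ν.real (ball x (2 * R + ρ)) ≤ D ^ 2 * ν.real (ball x R) := by
  have h1 : ν (ball x (2 * R + ρ)) ≤ (D : ℝ≥0∞) ^ 2 * ν (ball x R) :=
    (measure_mono (ball_subset_ball (by linarith))).trans (h.ball_pow_le x hR 2)
  have h2 := ENNReal.toReal_mono (ENNReal.mul_ne_top (by simp) (measure_ball_lt_top' x R).ne) h1
  simpa [Measure.real] using h2

include hν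

/-- Three factors `e^η` are lost: to the mass of the kernel escaping the collar, to the volume of
`(1+κ)B`, and to the oscillation of `log u_σ`. -/
lemma DoublingBound.measureReal_ball_le_exp {η κ σ c R : ℝ} {x : EuclideanSpace ℝ (Fin n)}
    (hR : 0 < R) (hκ0 : 0 < κ) (hκ1 : κ ≤ 1) (hκ : (1 + κ) ^ n ≤ Real.exp η) (hσ : 0 < σ)
    (hmass : Real.exp (-η) ≤ ∫ z : EuclideanSpace ℝ (Fin n) in ball 0 (κ * R), heatKernel σ z)
    (hosc : ∀ y ∈ ball x (2 * R), Real.log (heatAverage ν σ y) ≤ c + η) :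
    ν.real (ball x R) ≤ Real.exp (c + 3 * η) * volume.real (ball x R) := by
  have h1 := h.mul_measure_ball_le_integral_heatAverage hσ hmass x R
  have h2 : R + κ * R = (1 + κ) * R := by ring
  rw [h2] at h1
  have h3 : ∫ y in ball x ((1 + κ) * R), heatAverage ν σ y
      ≤ ∫ y in ball x ((1 + κ) * R), Real.exp (c + η) := by
    refine setIntegral_mono_on (h.integrableOn_heatAverage hσ x _)
      (integrableOn_const measure_ball_lt_top.ne) measurableSet_ball fun y hy => ?_
    rw [← Real.log_le_iff_le_exp (h.heatAverage_pos hν hσ y)]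
    exact hosc y (ball_subset_ball (by nlinarith) hy)
  rw [setIntegral_const, smul_eq_mul, volume_real_ball_mul (by linarith) hR] at h3
  have h4 : Real.exp (-η) * ν.real (ball x R)
      ≤ Real.exp (-η) * (Real.exp (c + 3 * η) * volume.real (ball x R)) := by
    calc _ ≤ (1 + κ) ^ n * volume.real (ball x R) * Real.exp (c + η) := h1.trans h3
      _ ≤ Real.exp η * volume.real (ball x R) * Real.exp (c + η) := by gcongr
      _ = _ := by
        have : Real.exp (-η) * Real.exp (c + 3 * η) = Real.exp η * Real.exp (c + η) := by
          rw [← Real.exp_add, ← Real.exp_add]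
          ring_nf
        rw [← mul_assoc, this]
        ring
  exact le_of_mul_le_mul_left h4 (Real.exp_pos _)

/-- The constant in the bound for integrals of Gaussian averages over balls. -/
noncomputable def ballAverageConst (n : ℕ) (D : ℝ≥0) : ℝ :=
  kernelConst n * expConst D * volume.real (ball (0 : EuclideanSpace ℝ (Fin n)) 1) * D ^ 2
    * Real.exp 3

omit hν in
lemma DoublingBound.integral_heatAverage_le_exp {η ρ c R : ℝ} {x : EuclideanSpace ℝ (Fin n)}
    (hR : 0 < R) (hη : η ≤ 1) (hρ : 0 < ρ) (hρR : ρ ≤ R)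
    (hνB : ν.real (ball x R) ≤ Real.exp (c + 3 * η) * volume.real (ball x R)) :
    ∫ y in ball x (2 * R), heatAverage ν ρ y
      ≤ Real.exp c * ballAverageConst n D * volume.real (ball x R) := by
  have hk := kernelConst_pos n
  calc _ ≤ kernelConst n * expConst D * volume.real (ball (0 : EuclideanSpace ℝ (Fin n)) 1)
          * ν.real (ball x (2 * R + ρ)) := h.integral_heatAverage_le hρ x (2 * R)
    _ ≤ kernelConst n * expConst D * volume.real (ball (0 : EuclideanSpace ℝ (Fin n)) 1)
          * (D ^ 2 * (Real.exp (c + 3 * η) * volume.real (ball x R))) := by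
        gcongr
        exact (h.measureReal_ball_le x hR hρR).trans (by gcongr)
    _ ≤ kernelConst n * expConst D * volume.real (ball (0 : EuclideanSpace ℝ (Fin n)) 1)
          * (D ^ 2 * (Real.exp (c + 3) * volume.real (ball x R))) := by
        gcongr
        linarith
    _ = _ := by
        rw [Real.exp_add, ballAverageConst]
        ring

/-- The height `m` is charged on all of `∫ ψ` and not just on `|B|`, which is why `κ` must be small
in terms of `η / (m+1)`. The leading `m` in the bound cancels later against the truncation level `c
+ m`. -/
lemma DoublingBound.integral_max_sub_log_le_of_oscillation {δ : ℝ} (hC : CarlesonBound ν δ)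
    {η κ m τ K σ c R : ℝ} {x : EuclideanSpace ℝ (Fin n)} (hR : 0 < R)
    (hη0 : 0 ≤ η) (hη1 : η ≤ 1) (hm : 0 ≤ m) (hκ1 : κ < 1)
    (hκ : (1 + κ) ^ n ≤ 1 + η / (m + 1)) (hK : 0 ≤ K) (hσ : 0 < σ) (hστ : σ ≤ τ * R)
    (hσR : σ < R) {ψ : EuclideanSpace ℝ (Fin n) → ℝ} (hψ : ContDiff ℝ 1 ψ) (hψ0 : ∀ y, 0 ≤ ψ y)
    (hψ1 : ∀ y, ψ y ≤ 1) (hψR : ∀ y ∈ ball x R, ψ y = 1)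
    (hsupp : tsupport ψ ⊆ closedBall x ((1 + κ) * R)) (hψK : ∀ y, ‖fderiv ℝ ψ y‖ ≤ K / R)
    (hψint : ∫ y, ψ y ≤ (1 + κ) ^ n * volume.real (ball x R))
    (hosc : ∀ y ∈ ball x (2 * R), c - η ≤ Real.log (heatAverage ν σ y))
    (hνB : ν.real (ball x R) ≤ Real.exp (c + 3 * η) * volume.real (ball x R))
    {ρ : ℝ} (hρ : 0 < ρ) (hρσ : ρ < σ) :
    ∫ y in ball x R, max (c + m - Real.log (heatAverage ν ρ y)) 0
      ≤ (m + 3 * η + 2 ^ n * (δ + (τ * K) ^ 2) + Real.exp (-m) * ballAverageConst n D)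
        * volume.real (ball x R) := by
  have hsupp2 : tsupport ψ ⊆ ball x (2 * R) :=
    hsupp.trans (closedBall_subset_ball (by nlinarith))
  have h1 := h.integral_max_sub_log_le hν hC hψ hψ0 hψ1 hψR hsupp2 hψK hρ hρσ.le hσR hosc (c + m)
  have h2 := h.integral_heatAverage_le_exp hR hη1 hρ (hρσ.trans hσR).le hνB
  set a := volume.real (ball x R) with ha
  have ha0 : 0 < a := volume_real_ball_pos hR x
  have h3 : Real.exp (-(c + m)) * ∫ y in ball x (2 * R), heatAverage ν ρ y
      ≤ Real.exp (-m) * ballAverageConst n D * a := by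
    calc _ ≤ Real.exp (-(c + m)) * (Real.exp c * ballAverageConst n D * a) := by gcongr
      _ = Real.exp (-(c + m) + c) * ballAverageConst n D * a := by rw [Real.exp_add]; ring
      _ = _ := by ring_nf
  have h4 : (c + m - (c - η)) * (∫ y, ψ y) ≤ (m + 3 * η) * a := by
    have h5 : c + m - (c - η) = m + η := by ring
    rw [h5]
    calc _ ≤ (m + η) * ((1 + η / (m + 1)) * a) := by
          refine mul_le_mul_of_nonneg_left (hψint.trans ?_) (by linarith)
          exact mul_le_mul_of_nonneg_right hκ ha0.le
      _ = ((m + η) * (1 + η / (m + 1))) * a := by ring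
      _ ≤ _ := by
        refine mul_le_mul_of_nonneg_right ?_ ha0.le
        have h6 : (m + η) * (η / (m + 1)) ≤ (m + 1) * (η / (m + 1)) :=
          mul_le_mul_of_nonneg_right (by linarith) (by positivity)
        have h7 : (m + 1) * (η / (m + 1)) = η := by field_simp
        linarith
  have h8 : (δ + (σ * (K / R)) ^ 2) * volume.real (ball x (2 * R))
      ≤ (δ + (τ * K) ^ 2) * (2 ^ n * a) := by
    rw [volume_real_ball_mul two_pos hR]
    have h9 : σ * (K / R) ≤ τ * K := by
      rw [← mul_div_assoc, div_le_iff₀ hR]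
      nlinarith
    have h10 : (σ * (K / R)) ^ 2 ≤ (τ * K) ^ 2 := pow_le_pow_left₀ (by positivity) h9 2
    exact mul_le_mul_of_nonneg_right (by linarith) (by positivity)
  linarith

omit h hν [IsLocallyFiniteMeasure ν]

/-- The parameters of the argument: the truncation height `m`, the relative thickness `κ` of the
cutoff, the oscillation `η`, and the relative scale `τ`. -/
lemma exists_parameters (n : ℕ) {C₁ E : ℝ} (hE : 0 < E) :
    ∃ m η κ : ℝ, 0 < m ∧ Real.exp (-m) * C₁ ≤ E / 4 ∧ 0 < η ∧ η ≤ 1 ∧ 6 * η ≤ E / 4 ∧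
      0 < κ ∧ κ < 1 ∧ (1 + κ) ^ n ≤ 1 + η / (m + 1) := by
  obtain ⟨m, hm0, hm⟩ : ∃ m : ℝ, 0 < m ∧ Real.exp (-m) * C₁ ≤ E / 4 := by
    have h1 : Filter.Tendsto (fun m : ℝ => Real.exp (-m) * C₁) Filter.atTop (nhds (0 * C₁)) :=
      (Real.tendsto_exp_neg_atTop_nhds_zero).mul_const C₁
    rw [zero_mul] at h1
    obtain ⟨m, h2, h3⟩ := ((h1.eventually_le_const (by positivity : 0 < E / 4)).and
      (Filter.eventually_gt_atTop 0)).exists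
    exact ⟨m, h3, h2⟩
  have hη0 : 0 < min 1 (E / 24) := lt_min one_pos (by positivity)
  have hηE : min 1 (E / 24) ≤ E / 24 := min_le_right _ _
  obtain ⟨κ, hκ0, hκ1, hκ⟩ := exists_one_add_pow_le n (t := 1 + min 1 (E / 24) / (m + 1))
    (by have : 0 < min 1 (E / 24) / (m + 1) := by positivity
        linarith)
  exact ⟨m, min 1 (E / 24), κ, hm0, hm, hη0, min_le_left _ _, by linarith, hκ0, hκ1, hκ⟩

lemma exists_scale_parameter (n : ℕ) {Q K κ E : ℝ} (hκ : 0 < κ) (hE : 0 < E) :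
    ∃ τ : ℝ, 0 < τ ∧ τ ≤ 1 ∧ Q * τ ≤ κ ∧ 2 ^ n * (τ * K) ^ 2 ≤ E := by
  have h1 : Filter.Tendsto (fun τ : ℝ => Q * τ) (nhdsWithin 0 (Set.Ioi 0)) (nhds 0) := by
    have : Continuous fun τ : ℝ => Q * τ := by fun_prop
    have h2 := this.tendsto 0
    rw [mul_zero] at h2
    exact h2.mono_left nhdsWithin_le_nhds
  have h2 : Filter.Tendsto (fun τ : ℝ => 2 ^ n * (τ * K) ^ 2) (nhdsWithin 0 (Set.Ioi 0))
      (nhds 0) := by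
    have : Continuous fun τ : ℝ => 2 ^ n * (τ * K) ^ 2 := by fun_prop
    have h2 := this.tendsto 0
    norm_num at h2
    exact h2.mono_left nhdsWithin_le_nhds
  obtain ⟨τ, ⟨h3, h4⟩, h5⟩ := (((h1.eventually_le_const hκ).and
    (h2.eventually_le_const hE)).and (Ioo_mem_nhdsGT one_pos)).exists
  exact ⟨τ, h5.1, h5.2.le, h3, h4⟩

lemma exists_forall_carlesonBound_aInftyBound (n : ℕ) (D : ℝ≥0) {E : ℝ} (hE : 0 < E) :
    ∃ δ₀ : ℝ, 0 < δ₀ ∧ ∀ w : EuclideanSpace ℝ (Fin n) → ℝ, IsWeight w →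
      DoublingBound (weightMeasure w) D → weightMeasure w ≠ 0 →
      CarlesonBound (weightMeasure w) δ₀ → AInftyBound w (Real.exp E).toNNReal := by
  -- The order matters: `m` depends on `n`, `D`, `E`; `κ` on `m` and `η`; the cutoff constant `K` on
  -- `κ`; `Q` on `η`; `τ` on `Q`, `K`, `κ`; and `δ` comes last. None depends on the weight or the
  -- ball.
  obtain ⟨m, η, κ, hm0, hm, hη0, hη1, hηE, hκ0, hκ1, hκ⟩ :=
    exists_parameters n (C₁ := ballAverageConst n D) hE
  have hκη : (1 + κ) ^ n ≤ Real.exp η := by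
    have h1 : η / (m + 1) ≤ η := div_le_self hη0.le (by linarith)
    have h2 := Real.add_one_le_exp η
    linarith
  obtain ⟨K, hK0, hcut⟩ := exists_cutoff n hκ0
  obtain ⟨Q, hQ0, hmass⟩ := exists_le_setIntegral_heatKernel n (θ := Real.exp (-η))
    (Real.exp_lt_one_iff.2 (by linarith))
  obtain ⟨τ, hτ0, hτ1, hτQ, hτK⟩ := exists_scale_parameter n (Q := Q) (K := K) hκ0
    (by positivity : 0 < E / 4)
  obtain ⟨δ₁, hδ₁0, hosc⟩ := exists_carleson_oscillation n D hη0 hτ0 hτ1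
  set δ := min δ₁ (E / (4 * 2 ^ n)) with hδ
  have hδ0 : 0 < δ := lt_min hδ₁0 (by positivity)
  have hδE : 2 ^ n * δ ≤ E / 4 := by
    have h1 : δ ≤ E / (4 * 2 ^ n) := min_le_right _ _
    rw [le_div_iff₀ (by positivity)] at h1
    linarith
  refine ⟨δ, hδ0, fun w hw h hν hC x R hR => ?_⟩
  have := hw.isLocallyFiniteMeasure
  obtain ⟨σ, hσ, hoscσ⟩ := hosc (weightMeasure w) h hν δ hδ0.le (min_le_left _ _) hC x R hR
  have hσ0 : 0 < σ := lt_trans (by positivity) hσ.1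
  have hστ : σ < τ * R := hσ.2
  have hσR : σ < R := hστ.trans_le (by nlinarith)
  set ν := weightMeasure w with hνdef
  set c := Real.log (heatAverage ν σ x) with hc
  set a := volume.real (ball x R) with ha
  have ha0 : 0 < a := volume_real_ball_pos hR x
  have hνB : ν.real (ball x R) ≤ Real.exp (c + 3 * η) * a := by
    refine h.measureReal_ball_le_exp hν hR hκ0 hκ1.le hκη hσ0
      (hmass σ (κ * R) hσ0 (by nlinarith)) fun y hy => ?_
    have := (abs_le.1 (hoscσ y hy)).2
    linarith
  obtain ⟨ψ, hψ, hψ0, hψ1, hψR, hsupp, hψK, hψint⟩ := hcut x R hR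
  have hbound := fun ρ (hρ : 0 < ρ) (hρσ : ρ < σ) =>
    h.integral_max_sub_log_le_of_oscillation hν hC hR hη0.le hη1 hm0.le hκ1 hκ hK0 hσ0
      hστ.le hσR hψ hψ0 hψ1 hψR hsupp hψK hψint (c := c) (fun y hy => by
        have := (abs_le.1 (hoscσ y hy)).1
        linarith) hνB hρ hρσ
  obtain ⟨hpos, hint, hlog⟩ := hw.integrableOn_log_of_forall_integral_le h hν hσ0 hbound
  have hgm : geometricMean w x R = Real.exp (⨍ z in ball x R, Real.log (w z)) :=
    if_pos ⟨hpos, hint⟩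
  rw [hgm, Real.coe_toNNReal _ (Real.exp_pos _).le, ← Real.exp_add, setAverage_eq, setAverage_eq,
    smul_eq_mul, smul_eq_mul, ← hw.measureReal_weightMeasure measurableSet_ball]
  have h1 : a⁻¹ * ν.real (ball x R) ≤ Real.exp (c + 3 * η) := by
    rw [inv_mul_le_iff₀ ha0, mul_comm a]
    exact hνB
  refine h1.trans (Real.exp_le_exp.2 ?_)
  have h2 : c - 3 * η - 2 ^ n * (δ + (τ * K) ^ 2) - Real.exp (-m) * ballAverageConst n D
      ≤ a⁻¹ * ∫ z in ball x R, Real.log (w z) := by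
    rw [le_inv_mul_iff₀ ha0]
    refine le_trans (le_of_eq ?_) hlog
    ring
  -- The four errors `6η`, `2^n δ`, `2^n (τK)²` and `e^{-m} C₁`, with `C₁` the ball average
  -- constant, are each at most `E/4`.
  linarith

end Main

theorem theorem1 (n : ℕ) (D : ℝ≥0) (ε₀ : ℝ) (hε₀ : 0 < ε₀) :
    ∃ δ₀ : ℝ, 0 < δ₀ ∧
      ∀ w : EuclideanSpace ℝ (Fin n) → ℝ, IsWeight w →
        IsDoubling (weightMeasure w) → doublingConstant (weightMeasure w) ≤ D →
        carlesonNorm (carlesonMeasure w) ≤ ENNReal.ofReal δ₀ →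
        aInftyConstant w ≤ ENNReal.ofReal (1 + ε₀) := by
  -- An infimum at most `D` provides an admissible doubling constant below `D + 1`, so `D + 1` is
  -- used throughout and attainment of the infimum is not needed.
  obtain ⟨δ₀, hδ₀, H⟩ := exists_forall_carlesonBound_aInftyBound n (D + 1)
    (E := Real.log (1 + ε₀)) (Real.log_pos (by linarith))
  refine ⟨δ₀, hδ₀, fun w hw hd hD hC => ?_⟩
  obtain ⟨C, hC', hlt⟩ := exists_lt_of_csInf_lt hd.2
    (hD.trans_lt (lt_add_one D) : doublingConstant (weightMeasure w) < D + 1)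
  have h : DoublingBound (weightMeasure w) (D + 1) := DoublingBound.mono hC' hlt.le
  have hA := H w hw h hd.1 (hw.carlesonBound h hd.1 hδ₀.le hC)
  rw [Real.exp_log (by linarith)] at hA
  exact iInf₂_le _ hA
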